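/- Proposition 1. Let $\omega_m>0$ and, for real parameters $(\gamma,\hat\delta)$, consider the Ince equation $$(1+\hat\delta\gamma\cos 2t)\,\ddot x-2\hat\delta\gamma\sin 2t\;\dot x+\frac{4\hat\delta}{\omega_m^2}\,x=0,$$ which is the (time-rescaled) linearisation about the origin of the undamped, unforced Helmholtz oscillator with mass $m(t)=\delta+\gamma\sin\omega_m t$, $\hat\delta=1/\delta$. For every integer $k\ge 1$ put $\hat\delta_0=\left(\frac{(2k-1)\omega_m}{2}\right)^2$. Then there are exactly two transition curves emanating from the point $(\gamma,\hat\delta)=(0,\hat\delta_0)$: there are functions $a,b$, real-analytic at $0$, with $a(0)=b(0)=\hat\delta_0$, such that for all $(\gamma,\hat\delta)$ in a neighbourhood of $(0,\hat\delta_0)$ 1. the equation has a nontrivial even $2\pi$-periodic solution if and only if $\hat\delta=a(\gamma)$, and a nontrivial odd $2\pi$-periodic solution if and only if $\hat\delta=b(\gamma)$; 2. $(\gamma,\hat\delta)$ lies on the stability boundary (the topological boundary of the set of parameters for which the origin $(x,\dot x)=(0,0)$ is Lyapunov stable) if and only if $\hat\delta=a(\gamma)$ or $\hat\delta=b(\gamma)$;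 3. the origin is unstable if and only if $\gamma\neq 0$ and $\hat\delta$ lies in the closed interval with endpoints $a(\gamma)$ and $b(\gamma)$ (the $k$-th instability tongue). The two curves coincide to order $\gamma^{2k-2}$ and split at order $\gamma^{2k-1}$: $a^{(j)}(0)=b^{(j)}(0)$ for $0\le j\le 2k-2$, and $a^{(2k-1)}(0)\neq b^{(2k-1)}(0)$. Consequently the width $|a(\gamma)-b(\gamma)|$ of the $k$-th instability tongue is of exact order $|\gamma|^{2k-1}$ as $\gamma\to 0$. -/

import Mathlib

open scoped Topology Asymptotics

/-- `x` is a (twice differentiable, global) solution of the linearisation of the undamped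
Helmholtz oscillator with periodically varying mass about the origin, in the rescaled form of an
Ince equation:
`(1 + δ γ cos 2t) x'' - 2 δ γ sin 2t x' + 4 (δ / ω²) x = 0`. -/
def IsInceSolution (ω γ δ : ℝ) (x : ℝ → ℝ) : Prop :=
  Differentiable ℝ x ∧ Differentiable ℝ (deriv x) ∧
    ∀ t : ℝ, (1 + δ * γ * Real.cos (2 * t)) * deriv (deriv x) t
      - 2 * (δ * γ) * Real.sin (2 * t) * deriv x t + 4 * (δ / ω ^ 2) * x t = 0

/-- Lyapunov stability of the origin `(x, x') = (0, 0)` at the parameters `(γ, δ)`. -/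
def OriginStable (ω γ δ : ℝ) : Prop :=
  ∀ ε > 0, ∃ η > 0, ∀ x : ℝ → ℝ, IsInceSolution ω γ δ x → |x 0| < η → |deriv x 0| < η →
    ∀ t ≥ 0, |x t| < ε ∧ |deriv x t| < ε

/-- The stability boundary in the `(γ, δ)` parameter plane: the frontier of the set of parameters
at which the origin is stable. -/
def stabilityBoundary (ω : ℝ) : Set (ℝ × ℝ) :=
  frontier {p : ℝ × ℝ | OriginStable ω p.1 p.2}

/-- At `(γ, δ)` there is a nontrivial even solution of period `2π`, which is twice the period `π`
of the coefficients. -/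
def HasEvenPeriodicSolution (ω γ δ : ℝ) : Prop :=
  ∃ x : ℝ → ℝ, IsInceSolution ω γ δ x ∧ x ≠ 0 ∧ Function.Periodic x (2 * Real.pi) ∧
    Function.Even x

/-- At `(γ, δ)` there is a nontrivial odd solution of period `2π`. -/
def HasOddPeriodicSolution (ω γ δ : ℝ) : Prop :=
  ∃ x : ℝ → ℝ, IsInceSolution ω γ δ x ∧ x ≠ 0 ∧ Function.Periodic x (2 * Real.pi) ∧
    Function.Odd x

/-! With ε = δγ and y = (1 + ε cos 2t) x', the equation becomes a π-periodic trace-free system. By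
the reflections t ↦ -t and t ↦ π - t its monodromy matrix is determined by half-period values: for F
= x₁(π/2) and G = y₂(π/2) both diagonal entries are 2FG - 1 and the off-diagonal entries have
product 4FG(FG - 1). Near a resonance FG < 1, so the origin is stable iff FG > 0 or F = G = 0, while
even (odd) 2π-periodic solutions exist iff F = 0 (G = 0). The reflection t ↦ π/2 - t changes ε to
-ε, so G(γ, δ) = F(-γ, δ).

F is analytic in the parameters (`exists_isInceFundamental`, by inverting a Volterra operator), and
F(0, δ) = cos(π√δ/ω) has a simple zero at the resonance. The implicit function theorem gives the
curve a, and b(γ) = a(-γ).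

For the width, the Fourier coefficients of x' at the odd frequencies 2j + 1, for the even solution
on F = 0, satisfy a three-term recurrence with spectral parameter 1/δ and coupling γ/2
(`IsInceSystem.isLadder`). After an alternating sign change the sequences z, w belonging to a(γ) and
b(γ) obey recurrences with the same coupling and opposite closing conditions at j = 0. A discrete
Lagrange identity then yields (1/a - 1/b) Σ z_j w_j = γ z_0 w_0. Both sequences peak at K = k - 1
and lose exactly one factor of γ per level below it, so z_0 w_0 is of order γ^(2K) z_K w_K and the
gap of exact order γ^(2K+1) (`IsLadder.gap`). -/

/-! ### The first order system and its symmetries. -/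

/-- The leading coefficient `1 + ε cos 2t` of the Ince equation. -/
noncomputable def inceCoeff (ε t : ℝ) : ℝ := 1 + ε * Real.cos (2 * t)

lemma inceCoeff_pos {ε : ℝ} (hε : |ε| < 1) (t : ℝ) : 0 < inceCoeff ε t := by
  have h : |ε * Real.cos (2 * t)| < 1 := by
    rw [abs_mul]
    exact (mul_le_of_le_one_right (abs_nonneg _) (Real.abs_cos_le_one _)).trans_lt hε
  have := (abs_lt.1 h).1
  unfold inceCoeff
  linarith

lemma inceCoeff_ge (ε t : ℝ) : 1 - |ε| ≤ inceCoeff ε t := by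
  have h : |ε * Real.cos (2 * t)| ≤ |ε| := by
    rw [abs_mul]
    exact mul_le_of_le_one_right (abs_nonneg _) (Real.abs_cos_le_one _)
  have := (abs_le.1 h).1
  unfold inceCoeff
  linarith

lemma hasDerivAt_inceCoeff (ε t : ℝ) :
    HasDerivAt (inceCoeff ε) (-2 * ε * Real.sin (2 * t)) t := by
  unfold inceCoeff
  have h := ((((hasDerivAt_id t).const_mul 2).cos).const_mul ε).const_add 1
  exact h.congr_deriv (by simp; ring)

lemma continuous_inceCoeff (ε : ℝ) : Continuous (inceCoeff ε) := by
  unfold inceCoeff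
  fun_prop

lemma inceCoeff_neg (ε t : ℝ) : inceCoeff ε (-t) = inceCoeff ε t := by
  simp [inceCoeff]

lemma inceCoeff_add_pi (ε t : ℝ) : inceCoeff ε (t + Real.pi) = inceCoeff ε t := by
  simp [inceCoeff, mul_add, Real.cos_add_two_pi]

lemma inceCoeff_pi_sub (ε t : ℝ) : inceCoeff ε (Real.pi - t) = inceCoeff ε t := by
  rw [show Real.pi - t = -t + Real.pi by ring, inceCoeff_add_pi, inceCoeff_neg]

/-- Source of the relation b(γ) = a(-γ) between the two curves. -/
lemma inceCoeff_pi_div_two_sub (ε t : ℝ) :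
    inceCoeff ε (Real.pi / 2 - t) = inceCoeff (-ε) t := by
  simp [inceCoeff, mul_sub, mul_div_cancel₀]

/-- The Ince equation `((1 + ε cos 2t) x')' + l x = 0` as a first order system, with
`y = (1 + ε cos 2t) x'`. -/
structure IsInceSystem (ε l : ℝ) (x y : ℝ → ℝ) : Prop where
  left : ∀ t, HasDerivAt x (y t / inceCoeff ε t) t
  right : ∀ t, HasDerivAt y (-l * x t) t

namespace IsInceSystem

variable {ε l : ℝ} {x y u v : ℝ → ℝ}

lemma continuous_left (h : IsInceSystem ε l x y) : Continuous x :=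
  continuous_iff_continuousAt.2 fun t => (h.left t).continuousAt

lemma continuous_right (h : IsInceSystem ε l x y) : Continuous y :=
  continuous_iff_continuousAt.2 fun t => (h.right t).continuousAt

/-- The system is trace free. Applied to a solution and a reflected one, this gives all the
half-period identities. -/
lemma wronskian_eq (h : IsInceSystem ε l x y) (h' : IsInceSystem ε l u v) (s t : ℝ) :
    x s * v s - u s * y s = x t * v t - u t * y t := by
  have hd : ∀ t, HasDerivAt (fun t => x t * v t - u t * y t) 0 t := fun t => by
    exact HasDerivAt.congr_deriv (((h.left t).mul (h'.right t)).sub ((h'.left t).mul (h.right t))) (by ring)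
  exact is_const_of_deriv_eq_zero (fun t => (hd t).differentiableAt) (fun t => (hd t).deriv) s t

lemma add_smul (h : IsInceSystem ε l x y) (h' : IsInceSystem ε l u v) (a b : ℝ) :
    IsInceSystem ε l (fun t => a * x t + b * u t) (fun t => a * y t + b * v t) where
  left t := by
    exact HasDerivAt.congr_deriv (((h.left t).const_mul a).add ((h'.left t).const_mul b)) (by ring)
  right t := by
    exact HasDerivAt.congr_deriv (((h.right t).const_mul a).add ((h'.right t).const_mul b)) (by ring)

lemma smul (h : IsInceSystem ε l x y) (a : ℝ) :
    IsInceSystem ε l (fun t => a * x t) (fun t => a * y t) := by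
  simpa using h.add_smul h a 0

lemma add_pi (h : IsInceSystem ε l x y) :
    IsInceSystem ε l (fun t => x (t + Real.pi)) (fun t => y (t + Real.pi)) where
  left t := by
    have := (h.left (t + Real.pi)).comp_add_const t Real.pi
    rwa [inceCoeff_add_pi] at this
  right t := (h.right (t + Real.pi)).comp_add_const t Real.pi

lemma reflect {ε' c : ℝ} (h : IsInceSystem ε l x y)
    (hp : ∀ t, inceCoeff ε (c - t) = inceCoeff ε' t) :
    IsInceSystem ε' l (fun t => x (c - t)) (fun t => -y (c - t)) where
  left t := by
    have := (h.left (c - t)).comp_const_sub c t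
    rw [hp] at this
    exact HasDerivAt.congr_deriv (this) (by ring)
  right t := by
    have := ((h.right (c - t)).comp_const_sub c t).neg
    exact HasDerivAt.congr_deriv (this) (by ring)

lemma neg_arg (h : IsInceSystem ε l x y) :
    IsInceSystem ε l (fun t => x (-t)) (fun t => -y (-t)) := by
  have := h.reflect (ε' := ε) (c := 0) (fun t => by simp [inceCoeff_neg])
  simpa using this

end IsInceSystem

lemma IsInceSolution.isInceSystem {ω γ δ : ℝ} {x : ℝ → ℝ} (h : IsInceSolution ω γ δ x) :
    |δ * γ| < 1 →
    IsInceSystem (δ * γ) (4 * (δ / ω ^ 2)) x (fun t => inceCoeff (δ * γ) t * deriv x t) :=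
  fun hε => {
    left := fun t => by
      rw [mul_div_cancel_left₀ _ (inceCoeff_pos hε t).ne']
      exact (h.1 t).hasDerivAt
    right := fun t => by
      have := h.2.2 t
      rw [← inceCoeff] at this
      exact ((hasDerivAt_inceCoeff (δ * γ) t).mul (h.2.1 t).hasDerivAt).congr_deriv
        (by linarith) }

lemma IsInceSystem.deriv_left {ε l : ℝ} {x y : ℝ → ℝ} (h : IsInceSystem ε l x y) :
    deriv x = fun t => y t / inceCoeff ε t :=
  funext fun t => (h.left t).deriv

lemma IsInceSystem.isInceSolution {ω γ δ : ℝ} {x y : ℝ → ℝ} (hε : |δ * γ| < 1)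
    (h : IsInceSystem (δ * γ) (4 * (δ / ω ^ 2)) x y) : IsInceSolution ω γ δ x := by
  have hd : ∀ t, HasDerivAt (deriv x) _ t := fun t => by
    rw [h.deriv_left]
    exact (h.right t).div (hasDerivAt_inceCoeff _ t) (inceCoeff_pos hε t).ne'
  refine ⟨fun t => (h.left t).differentiableAt, fun t => (hd t).differentiableAt, fun t => ?_⟩
  have hp := (inceCoeff_pos hε t).ne'
  rw [(hd t).deriv, h.deriv_left, ← inceCoeff]
  field_simp
  ring

/-! ### The monodromy matrix in terms of values at π/2. -/

/-- The two solutions with initial values `(1, 0)` and `(0, 1)`. -/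
structure IsInceFundamental (ε l : ℝ) (x₁ y₁ x₂ y₂ : ℝ → ℝ) : Prop where
  fst : IsInceSystem ε l x₁ y₁
  snd : IsInceSystem ε l x₂ y₂
  x₁_zero : x₁ 0 = 1
  y₁_zero : y₁ 0 = 0
  x₂_zero : x₂ 0 = 0
  y₂_zero : y₂ 0 = 1

namespace IsInceFundamental

variable {ε l : ℝ} {x₁ y₁ x₂ y₂ u v : ℝ → ℝ}

lemma wronskian (h : IsInceFundamental ε l x₁ y₁ x₂ y₂) (t : ℝ) :
    x₁ t * y₂ t - x₂ t * y₁ t = 1 := by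
  rw [h.fst.wronskian_eq h.snd t 0]
  simp [h.x₁_zero, h.y₁_zero, h.x₂_zero, h.y₂_zero]

lemma left_eq (h : IsInceFundamental ε l x₁ y₁ x₂ y₂) (hu : IsInceSystem ε l u v) (t : ℝ) :
    u t = u 0 * x₁ t + v 0 * x₂ t := by
  have h1 := hu.wronskian_eq h.snd t 0
  have h2 := h.fst.wronskian_eq hu t 0
  have h3 := h.wronskian t
  simp only [h.x₁_zero, h.y₁_zero, h.x₂_zero, h.y₂_zero] at h1 h2
  linear_combination x₁ t * h1 + x₂ t * h2 - u t * h3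

lemma right_eq (h : IsInceFundamental ε l x₁ y₁ x₂ y₂) (hu : IsInceSystem ε l u v) (t : ℝ) :
    v t = u 0 * y₁ t + v 0 * y₂ t := by
  have h1 := hu.wronskian_eq h.snd t 0
  have h2 := h.fst.wronskian_eq hu t 0
  have h3 := h.wronskian t
  simp only [h.x₁_zero, h.y₁_zero, h.x₂_zero, h.y₂_zero] at h1 h2
  linear_combination y₁ t * h1 + y₂ t * h2 - v t * h3

/-- The Wronskian of a fundamental solution with a solution reflected about π/2 is compared at 0 and
π/2; the other three entries follow in the same way. -/
lemma y₁_pi (h : IsInceFundamental ε l x₁ y₁ x₂ y₂) :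
    y₁ Real.pi = 2 * (x₁ (Real.pi / 2) * y₁ (Real.pi / 2)) := by
  have := h.fst.wronskian_eq (h.fst.reflect (inceCoeff_pi_sub ε)) 0 (Real.pi / 2)
  simp only [h.x₁_zero, h.y₁_zero, sub_zero, sub_half] at this
  linarith

lemma x₂_pi (h : IsInceFundamental ε l x₁ y₁ x₂ y₂) :
    x₂ Real.pi = 2 * (x₂ (Real.pi / 2) * y₂ (Real.pi / 2)) := by
  have := h.snd.wronskian_eq (h.snd.reflect (inceCoeff_pi_sub ε)) 0 (Real.pi / 2)
  simp only [h.x₂_zero, h.y₂_zero, sub_zero, sub_half] at this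
  linarith

lemma y₂_pi (h : IsInceFundamental ε l x₁ y₁ x₂ y₂) :
    y₂ Real.pi = 2 * (x₁ (Real.pi / 2) * y₂ (Real.pi / 2)) - 1 := by
  have := h.fst.wronskian_eq (h.snd.reflect (inceCoeff_pi_sub ε)) 0 (Real.pi / 2)
  simp only [h.x₁_zero, h.y₁_zero, sub_zero, sub_half] at this
  linarith [h.wronskian (Real.pi / 2)]

lemma x₁_pi (h : IsInceFundamental ε l x₁ y₁ x₂ y₂) :
    x₁ Real.pi = 2 * (x₁ (Real.pi / 2) * y₂ (Real.pi / 2)) - 1 := by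
  have := h.snd.wronskian_eq (h.fst.reflect (inceCoeff_pi_sub ε)) 0 (Real.pi / 2)
  simp only [h.x₂_zero, h.y₂_zero, sub_zero, sub_half] at this
  linarith [h.wronskian (Real.pi / 2)]

/-- The half-period values of the two fundamental solutions are exchanged by `ε ↦ -ε`. -/
lemma y₂_pi_div_two (h : IsInceFundamental ε l x₁ y₁ x₂ y₂) (hu : IsInceSystem (-ε) l u v)
    (hu0 : u 0 = 1) (hv0 : v 0 = 0) : y₂ (Real.pi / 2) = u (Real.pi / 2) := by
  have hr := hu.reflect (ε' := ε) (c := Real.pi / 2)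
    (fun t => by rw [inceCoeff_pi_div_two_sub, neg_neg])
  have := hr.wronskian_eq h.snd 0 (Real.pi / 2)
  simp only [h.x₂_zero, h.y₂_zero, sub_zero, sub_self, hu0, hv0] at this
  linarith

lemma add_pi_left (h : IsInceFundamental ε l x₁ y₁ x₂ y₂) (hu : IsInceSystem ε l u v) (t : ℝ) :
    u (t + Real.pi) = u Real.pi * x₁ t + v Real.pi * x₂ t := by
  simpa using h.left_eq hu.add_pi t

end IsInceFundamental

/-! ### Stability criterion. -/

/-- Since |2m| ≥ 2, the increments of |s n| never decrease. This includes the parabolic case m = -1,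
where growth may be only linear. -/
lemma abs_ge_of_linear_recurrence {m : ℝ} (hm : m ≤ -1) {s : ℕ → ℝ} (h0 : s 0 = 0)
    (hs : ∀ n, s (n + 2) = 2 * m * s (n + 1) - s n) (n : ℕ) : n * |s 1| ≤ |s n| := by
  have key : ∀ n, |s n| + |s 1| ≤ |s (n + 1)| := by
    intro n
    induction n with
    | zero => simp [h0]
    | succ n ih =>
      have h1 : |2 * m * s (n + 1)| ≤ |s (n + 2)| + |s n| := by
        rw [show 2 * m * s (n + 1) = s (n + 2) + s n by rw [hs]; ring]
        exact abs_add_le _ _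
      have h2 : 2 * |s (n + 1)| ≤ |2 * m * s (n + 1)| := by
        rw [abs_mul]
        refine mul_le_mul_of_nonneg_right ?_ (abs_nonneg _)
        rw [abs_of_neg (by linarith)]
        linarith
      linarith
  induction n with
  | zero => simp
  | succ n ih =>
    push_cast
    linarith [key n]

/-- A matrix `!![m, B; C, m]` of determinant one with `B C < 0` preserves a definite form. -/
lemma invariant_form {m B C : ℝ} (hdet : m ^ 2 - B * C = 1) (hBC : B * C < 0) (u v : ℝ) :
    |C| * (m * u + B * v) ^ 2 + |B| * (C * u + m * v) ^ 2 = |C| * u ^ 2 + |B| * v ^ 2 := by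
  rcases mul_neg_iff.1 hBC with ⟨hB, hC⟩ | ⟨hB, hC⟩
  · rw [abs_of_pos hB, abs_of_neg hC]
    linear_combination (-C * u ^ 2 + B * v ^ 2) * hdet
  · rw [abs_of_neg hB, abs_of_pos hC]
    linear_combination (C * u ^ 2 - B * v ^ 2) * hdet

lemma IsInceSystem.add_nat_mul_pi {ε l : ℝ} {u v : ℝ → ℝ} (hu : IsInceSystem ε l u v) (n : ℕ) :
    IsInceSystem ε l (fun t => u (t + n * Real.pi)) (fun t => v (t + n * Real.pi)) := by
  induction n with
  | zero => simpa using hu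
  | succ n ih =>
    have := ih.add_pi
    have e : ∀ t : ℝ, t + ((n + 1 : ℕ) : ℝ) * Real.pi = t + Real.pi + n * Real.pi := fun t => by
      push_cast
      ring
    simpa only [e] using this

namespace IsInceFundamental

variable {ε l : ℝ} {x₁ y₁ x₂ y₂ u v : ℝ → ℝ}

lemma iterate_pi (h : IsInceFundamental ε l x₁ y₁ x₂ y₂) (hu : IsInceSystem ε l u v) (n : ℕ) :
    u ((n + 1 : ℕ) * Real.pi) =
      x₁ Real.pi * u (n * Real.pi) + x₂ Real.pi * v (n * Real.pi) ∧
    v ((n + 1 : ℕ) * Real.pi) =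
      y₁ Real.pi * u (n * Real.pi) + y₂ Real.pi * v (n * Real.pi) := by
  have hs := hu.add_nat_mul_pi n
  have h1 := h.left_eq hs Real.pi
  have h2 := h.right_eq hs Real.pi
  simp only [zero_add] at h1 h2
  rw [show ((n + 1 : ℕ) : ℝ) * Real.pi = Real.pi + n * Real.pi by push_cast; ring]
  constructor <;> linarith

/-- Cayley–Hamilton for the monodromy matrix, of determinant 1 and trace 2 x₁(π). -/
lemma second_order_recurrence (h : IsInceFundamental ε l x₁ y₁ x₂ y₂)
    (hu : IsInceSystem ε l u v) (n : ℕ) :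
    u ((n + 2 : ℕ) * Real.pi) =
      2 * x₁ Real.pi * u ((n + 1 : ℕ) * Real.pi) - u (n * Real.pi) ∧
    v ((n + 2 : ℕ) * Real.pi) =
      2 * x₁ Real.pi * v ((n + 1 : ℕ) * Real.pi) - v (n * Real.pi) := by
  obtain ⟨a1, a2⟩ := h.iterate_pi hu n
  obtain ⟨b1, b2⟩ := h.iterate_pi hu (n + 1)
  have hw := h.wronskian Real.pi
  have hd : y₂ Real.pi = x₁ Real.pi := by rw [h.x₁_pi, h.y₂_pi]
  rw [hd] at hw a2 b2
  constructor
  · rw [b1]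
    linear_combination x₂ Real.pi * a2 - x₁ Real.pi * a1 - u (n * Real.pi) * hw
  · rw [b2]
    linear_combination y₁ Real.pi * a1 - x₁ Real.pi * a2 - v (n * Real.pi) * hw

/-- For 0 < FG < 1 the off-diagonal product 4FG(FG - 1) is negative and the monodromy preserves a
definite quadratic form; for F = G = 0 it is minus the identity. -/
lemma exists_bound_at_multiples (h : IsInceFundamental ε l x₁ y₁ x₂ y₂)
    (hlt : x₁ (Real.pi / 2) * y₂ (Real.pi / 2) < 1)
    (hst : 0 < x₁ (Real.pi / 2) * y₂ (Real.pi / 2) ∨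
      x₁ (Real.pi / 2) = 0 ∧ y₂ (Real.pi / 2) = 0) :
    ∃ R, 0 < R ∧ ∀ u v, IsInceSystem ε l u v → ∀ n : ℕ,
      u (n * Real.pi) ^ 2 + v (n * Real.pi) ^ 2 ≤ R * (u 0 ^ 2 + v 0 ^ 2) := by
  have hw := h.wronskian Real.pi
  have hwh := h.wronskian (Real.pi / 2)
  have hd : y₂ Real.pi = x₁ Real.pi := by rw [h.x₁_pi, h.y₂_pi]
  rcases hst with hst | ⟨hF, hG⟩
  · have hBC : x₂ Real.pi * y₁ Real.pi < 0 := by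
      rw [h.x₂_pi, h.y₁_pi]
      nlinarith
    have hdet : x₁ Real.pi ^ 2 - x₂ Real.pi * y₁ Real.pi = 1 := by
      rw [hd] at hw
      linarith
    have hB : 0 < |x₂ Real.pi| := abs_pos.2 (left_ne_zero_of_mul hBC.ne)
    have hC : 0 < |y₁ Real.pi| := abs_pos.2 (right_ne_zero_of_mul hBC.ne)
    have hmin : 0 < min |x₂ Real.pi| |y₁ Real.pi| := lt_min hB hC
    refine ⟨(|x₂ Real.pi| + |y₁ Real.pi|) / min |x₂ Real.pi| |y₁ Real.pi|, by positivity,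
      fun u v hu n => ?_⟩
    have hinv : |y₁ Real.pi| * u (n * Real.pi) ^ 2 + |x₂ Real.pi| * v (n * Real.pi) ^ 2 =
        |y₁ Real.pi| * u 0 ^ 2 + |x₂ Real.pi| * v 0 ^ 2 := by
      induction n with
      | zero => simp
      | succ n ih =>
        obtain ⟨a1, a2⟩ := h.iterate_pi hu n
        rw [a1, a2, hd, invariant_form hdet hBC, ih]
    rw [div_mul_eq_mul_div, le_div_iff₀ hmin]
    have h1 := mul_le_mul_of_nonneg_right (min_le_left |x₂ Real.pi| |y₁ Real.pi|)
      (sq_nonneg (v (n * Real.pi)))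
    have h2 := mul_le_mul_of_nonneg_right (min_le_right |x₂ Real.pi| |y₁ Real.pi|)
      (sq_nonneg (u (n * Real.pi)))
    nlinarith [mul_nonneg hB.le (sq_nonneg (u 0)), mul_nonneg hC.le (sq_nonneg (v 0))]
  · refine ⟨1, one_pos, fun u v hu n => ?_⟩
    induction n with
    | zero => simp
    | succ n ih =>
      obtain ⟨a1, a2⟩ := h.iterate_pi hu n
      rw [a1, a2, hd, h.x₂_pi, h.y₁_pi, h.x₁_pi, hF, hG]
      simpa using ih

lemma exists_bound (h : IsInceFundamental ε l x₁ y₁ x₂ y₂)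
    (hlt : x₁ (Real.pi / 2) * y₂ (Real.pi / 2) < 1)
    (hst : 0 < x₁ (Real.pi / 2) * y₂ (Real.pi / 2) ∨
      x₁ (Real.pi / 2) = 0 ∧ y₂ (Real.pi / 2) = 0) :
    ∃ R, 0 < R ∧ ∀ u v, IsInceSystem ε l u v → ∀ η, |u 0| ≤ η → |v 0| ≤ η →
      ∀ t, 0 ≤ t → |u t| ≤ R * η ∧ |v t| ≤ R * η := by
  obtain ⟨R, hR, hbd⟩ := h.exists_bound_at_multiples hlt hst
  obtain ⟨S, hS⟩ : ∃ S, ∀ s ∈ Set.Icc 0 Real.pi,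
      |x₁ s| + |x₂ s| ≤ S ∧ |y₁ s| + |y₂ s| ≤ S := by
    have hc : Continuous fun s => (|x₁ s| + |x₂ s|) + (|y₁ s| + |y₂ s|) :=
      (h.fst.continuous_left.abs.add h.snd.continuous_left.abs).add
        (h.fst.continuous_right.abs.add h.snd.continuous_right.abs)
    obtain ⟨S, hS⟩ := isCompact_Icc.exists_bound_of_continuousOn (s := Set.Icc 0 Real.pi)
      hc.continuousOn
    refine ⟨S, fun s hs => ?_⟩
    have := (le_abs_self _).trans (hS s hs)
    constructor <;> linarith [abs_nonneg (x₁ s), abs_nonneg (x₂ s), abs_nonneg (y₁ s),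
      abs_nonneg (y₂ s)]
  have hS0 : 0 ≤ S := (by positivity : 0 ≤ |x₁ 0| + |x₂ 0|).trans
    (hS 0 ⟨le_rfl, Real.pi_pos.le⟩).1
  -- The factor 2 comes from u(0)² + v(0)² ≤ 2η².
  set r := √(2 * R) with hr
  have hr0 : 0 < r := Real.sqrt_pos.2 (by positivity)
  have hr2 : r ^ 2 = 2 * R := Real.sq_sqrt (by positivity)
  refine ⟨(S + 1) * r, by positivity, fun u v hu η hu0 hv0 t ht => ?_⟩
  have hη : 0 ≤ η := (abs_nonneg _).trans hu0
  obtain ⟨n, s, hs, rfl⟩ : ∃ n : ℕ, ∃ s ∈ Set.Icc 0 Real.pi, s + n * Real.pi = t := by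
    have hp := Real.pi_pos
    refine ⟨⌊t / Real.pi⌋₊, t - ⌊t / Real.pi⌋₊ * Real.pi, ⟨?_, ?_⟩, by ring⟩
    · have := Nat.floor_le (a := t / Real.pi) (by positivity)
      rw [le_div_iff₀ hp] at this
      linarith
    · have := (Nat.lt_floor_add_one (t / Real.pi)).le
      rw [div_le_iff₀ hp] at this
      linarith
  have hsq : u (n * Real.pi) ^ 2 + v (n * Real.pi) ^ 2 ≤ (r * η) ^ 2 := by
    refine (hbd u v hu n).trans ?_
    have h1 := sq_le_sq' (by linarith [abs_nonneg (u 0)]) hu0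
    have h2 := sq_le_sq' (by linarith [abs_nonneg (v 0)]) hv0
    rw [sq_abs] at h1 h2
    rw [mul_pow, hr2]
    nlinarith
  have hun : |u (n * Real.pi)| ≤ r * η :=
    abs_le_of_sq_le_sq (by nlinarith [sq_nonneg (v (n * Real.pi))]) (by positivity)
  have hvn : |v (n * Real.pi)| ≤ r * η :=
    abs_le_of_sq_le_sq (by nlinarith [sq_nonneg (u (n * Real.pi))]) (by positivity)
  have hs' := hu.add_nat_mul_pi n
  have e1 := h.left_eq hs' s
  have e2 := h.right_eq hs' s
  simp only [zero_add] at e1 e2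
  have aux : ∀ a b : ℝ, |a| + |b| ≤ S →
      |u (n * Real.pi) * a + v (n * Real.pi) * b| ≤ (S + 1) * r * η := fun a b hab => by
    calc |u (n * Real.pi) * a + v (n * Real.pi) * b|
        ≤ |u (n * Real.pi)| * |a| + |v (n * Real.pi)| * |b| := by
          rw [← abs_mul, ← abs_mul]
          exact abs_add_le _ _
      _ ≤ r * η * |a| + r * η * |b| := by gcongr
      _ = r * η * (|a| + |b|) := by ring
      _ ≤ r * η * (S + 1) := mul_le_mul_of_nonneg_left (by linarith) (by positivity)
      _ = (S + 1) * r * η := by ring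
  rw [e1, e2]
  exact ⟨aux _ _ (hS s hs).1, aux _ _ (hS s hs).2⟩

end IsInceFundamental

lemma originStable_of_pos {ω γ δ : ℝ} {x₁ y₁ x₂ y₂ : ℝ → ℝ} (hε : |δ * γ| < 1)
    (h : IsInceFundamental (δ * γ) (4 * (δ / ω ^ 2)) x₁ y₁ x₂ y₂)
    (hlt : x₁ (Real.pi / 2) * y₂ (Real.pi / 2) < 1)
    (hst : 0 < x₁ (Real.pi / 2) * y₂ (Real.pi / 2) ∨
      x₁ (Real.pi / 2) = 0 ∧ y₂ (Real.pi / 2) = 0) :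
    OriginStable ω γ δ := by
  obtain ⟨R, hR, hbd⟩ := h.exists_bound hlt hst
  intro e he
  set c := 1 - |δ * γ| with hc
  have hc0 : 0 < c := by linarith
  have hc1 : c ≤ 1 := by linarith [abs_nonneg (δ * γ)]
  -- Passing from x'(0) to y(0) costs at most a factor 2, so |x| and |y| stay below c e / 2;
  -- returning from y(t) to x'(t) costs at most 1/c.
  refine ⟨c * e / (4 * R), by positivity, fun x hx h0 h1 t ht => ?_⟩
  have hp0 : inceCoeff (δ * γ) 0 ≤ 2 := by
    have := le_abs_self (δ * γ)
    simp only [inceCoeff, mul_zero, Real.cos_zero, mul_one]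
    linarith
  have hpos := inceCoeff_pos hε 0
  have hv0 : |inceCoeff (δ * γ) 0 * deriv x 0| ≤ 2 * (c * e / (4 * R)) := by
    rw [abs_mul, abs_of_pos hpos]
    gcongr
  have hu0 : |x 0| ≤ 2 * (c * e / (4 * R)) := h0.le.trans (by
    have : 0 < c * e / (4 * R) := by positivity
    linarith)
  obtain ⟨b1, b2⟩ := hbd x _ (hx.isInceSystem hε) _ hu0 hv0 t ht
  have hval : R * (2 * (c * e / (4 * R))) = c * e / 2 := by
    field_simp
    ring
  rw [hval] at b1 b2
  have hce : c * e ≤ e := mul_le_of_le_one_left he.le hc1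
  refine ⟨by linarith, ?_⟩
  have hpt := inceCoeff_pos hε t
  rw [abs_mul, abs_of_pos hpt] at b2
  have hge := mul_le_mul_of_nonneg_right (inceCoeff_ge (δ * γ) t) (abs_nonneg (deriv x t))
  have : c * |deriv x t| < c * e := by
    have := mul_pos hc0 he
    linarith
  exact lt_of_mul_lt_mul_left this hc0.le

/-- By linearity an unbounded solution can be rescaled to have arbitrarily small initial data. -/
lemma not_originStable_of_unbounded {ω γ δ : ℝ} {x y : ℝ → ℝ} (hε : |δ * γ| < 1)
    (h : IsInceSystem (δ * γ) (4 * (δ / ω ^ 2)) x y)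
    (hunb : ∀ R, ∃ t, 0 ≤ t ∧ (R < |x t| ∨ R < |deriv x t|)) : ¬ OriginStable ω γ δ := by
  intro hst
  obtain ⟨η, hη, H⟩ := hst 1 one_pos
  set c := η / (1 + |x 0| + |deriv x 0|) with hc
  have hden : 0 < 1 + |x 0| + |deriv x 0| := by positivity
  have hc0 : 0 < c := by positivity
  have hsol := (h.smul c).isInceSolution hε
  have hder : ∀ t, deriv (fun t => c * x t) t = c * deriv x t := fun t =>
    deriv_const_mul c (h.left t).differentiableAt
  have hlt : ∀ a, a < 1 + |x 0| + |deriv x 0| → c * a < η := fun a ha => by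
    rw [hc, div_mul_eq_mul_div, div_lt_iff₀ hden]
    exact mul_lt_mul_of_pos_left ha hη
  have hH := H _ hsol
    (by rw [abs_mul, abs_of_pos hc0]; exact hlt _ (by linarith [abs_nonneg (deriv x 0)]))
    (by rw [hder, abs_mul, abs_of_pos hc0]; exact hlt _ (by linarith [abs_nonneg (x 0)]))
  obtain ⟨t, ht, hR⟩ := hunb (1 / c)
  obtain ⟨b1, b2⟩ := hH t ht
  rw [hder] at b2
  rw [abs_mul, abs_of_pos hc0] at b1 b2
  rw [div_lt_iff₀' hc0, div_lt_iff₀' hc0] at hR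
  rcases hR with hR | hR <;> linarith

lemma not_originStable_of_nonpos {ω γ δ : ℝ} {x₁ y₁ x₂ y₂ : ℝ → ℝ} (hε : |δ * γ| < 1)
    (h : IsInceFundamental (δ * γ) (4 * (δ / ω ^ 2)) x₁ y₁ x₂ y₂)
    (hle : x₁ (Real.pi / 2) * y₂ (Real.pi / 2) ≤ 0)
    (hne : ¬ (x₁ (Real.pi / 2) = 0 ∧ y₂ (Real.pi / 2) = 0)) :
    ¬ OriginStable ω γ δ := by
  have hm : x₁ Real.pi ≤ -1 := by
    rw [h.x₁_pi]
    linarith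
  have hHK : x₂ (Real.pi / 2) * y₁ (Real.pi / 2) ≠ 0 := by
    have := h.wronskian (Real.pi / 2)
    intro h0
    linarith
  have hgrow : ∀ s : ℕ → ℝ, s 0 = 0 → s 1 ≠ 0 →
      (∀ n, s (n + 2) = 2 * x₁ Real.pi * s (n + 1) - s n) → ∀ R, ∃ n, R < |s n| := by
    intro s h0 h1 hs R
    obtain ⟨n, hn⟩ := exists_nat_gt (R / |s 1|)
    rw [div_lt_iff₀ (abs_pos.2 h1)] at hn
    exact ⟨n, hn.trans_le (abs_ge_of_linear_recurrence hm h0 hs n)⟩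
  -- Some off-diagonal monodromy entry is nonzero: y₁(π) if F ≠ 0, x₂(π) if G ≠ 0. The corresponding
  -- sequence starts at 0 and grows at least linearly.
  by_cases hG : y₂ (Real.pi / 2) = 0
  · have hF : x₁ (Real.pi / 2) ≠ 0 := fun hF => hne ⟨hF, hG⟩
    refine not_originStable_of_unbounded hε h.fst fun R => ?_
    obtain ⟨n, hn⟩ := hgrow (fun n => y₁ (n * Real.pi)) (by simp [h.y₁_zero])
      (by simp [h.y₁_pi, hF, right_ne_zero_of_mul hHK])
      -- The factor 2 bounds the leading coefficient when y is converted back to x'.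
      (fun n => (h.second_order_recurrence h.fst n).2) (2 * |R|)
    refine ⟨n * Real.pi, by positivity, Or.inr ?_⟩
    have hp := inceCoeff_pos hε (n * Real.pi)
    have hp2 : inceCoeff (δ * γ) (n * Real.pi) ≤ 2 := by
      have h1 := (abs_mul (δ * γ) (Real.cos (2 * (n * Real.pi)))).le.trans
        (mul_le_of_le_one_right (abs_nonneg _) (Real.abs_cos_le_one _))
      have h2 := le_abs_self (δ * γ * Real.cos (2 * (n * Real.pi)))
      unfold inceCoeff
      linarith
    rw [h.fst.deriv_left, abs_div, abs_of_pos hp, lt_div_iff₀ hp]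
    have h3 := le_abs_self R
    have h4 := abs_nonneg R
    nlinarith
  · refine not_originStable_of_unbounded hε h.snd fun R => ?_
    obtain ⟨n, hn⟩ := hgrow (fun n => x₂ (n * Real.pi)) (by simp [h.x₂_zero])
      (by simp [h.x₂_pi, hG, left_ne_zero_of_mul hHK])
      (fun n => (h.second_order_recurrence h.snd n).1) R
    exact ⟨n * Real.pi, by positivity, Or.inl hn⟩

/-! ### Periodic solutions of either parity. -/

lemma deriv_eq_zero_of_symm {x : ℝ → ℝ} (hx : Differentiable ℝ x) {c : ℝ}
    (hs : ∀ t, x (2 * c - t) = x t) : deriv x c = 0 := by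
  have h1 := ((hx (2 * c - c)).hasDerivAt).comp_const_sub (2 * c) c
  have h2 : (fun t => x (2 * c - t)) = x := funext hs
  rw [h2, show 2 * c - c = c by ring] at h1
  linarith [h1.deriv]

/-- Evenness and periodicity force x'(0) = x'(π) = 0, so x is a multiple of x₁ and y₁(π) = 2F
y₁(π/2) vanishes; y₁(π/2) ≠ 0 because x₂ y₁ = FG - 1 at π/2. Conversely F = 0 makes x₁ antiperiodic
under the shift by π. -/
lemma hasEvenPeriodicSolution_iff {ω γ δ : ℝ} {x₁ y₁ x₂ y₂ : ℝ → ℝ} (hε : |δ * γ| < 1)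
    (h : IsInceFundamental (δ * γ) (4 * (δ / ω ^ 2)) x₁ y₁ x₂ y₂)
    (hlt : x₁ (Real.pi / 2) * y₂ (Real.pi / 2) < 1) :
    HasEvenPeriodicSolution ω γ δ ↔ x₁ (Real.pi / 2) = 0 := by
  have hHK : x₂ (Real.pi / 2) * y₁ (Real.pi / 2) ≠ 0 := by
    have := h.wronskian (Real.pi / 2)
    intro h0
    linarith
  constructor
  · rintro ⟨x, hx, hne, hper, heven⟩
    have hsys := hx.isInceSystem hε
    have hd0 : deriv x 0 = 0 := deriv_eq_zero_of_symm hx.1 fun t => by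
      rw [mul_zero, zero_sub, heven]
    have hdpi : deriv x Real.pi = 0 := deriv_eq_zero_of_symm hx.1 fun t => by
      rw [← heven, neg_sub, hper.sub_eq]
    have hrep := h.right_eq hsys Real.pi
    have hl := h.left_eq hsys
    simp only [hd0, hdpi, mul_zero, zero_mul, add_zero] at hrep hl
    have hx0 : x 0 ≠ 0 := fun h0 => hne (funext fun t => by simp [hl t, h0])
    have hy := (mul_eq_zero.1 hrep.symm).resolve_left hx0
    rw [h.y₁_pi] at hy
    simpa [right_ne_zero_of_mul hHK] using hy
  · intro hF
    have hshift : ∀ t, x₁ (t + Real.pi) = -x₁ t := fun t => by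
      rw [h.add_pi_left h.fst, h.y₁_pi, h.x₁_pi, hF]
      ring
    refine ⟨x₁, h.fst.isInceSolution hε, fun h0 => ?_, fun t => ?_, fun t => ?_⟩
    · simpa [h0] using h.x₁_zero
    · rw [two_mul, ← add_assoc, hshift, hshift, neg_neg]
    · have := h.left_eq h.fst.neg_arg t
      simpa [h.x₁_zero, h.y₁_zero] using this

lemma hasOddPeriodicSolution_iff {ω γ δ : ℝ} {x₁ y₁ x₂ y₂ : ℝ → ℝ} (hε : |δ * γ| < 1)
    (h : IsInceFundamental (δ * γ) (4 * (δ / ω ^ 2)) x₁ y₁ x₂ y₂)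
    (hlt : x₁ (Real.pi / 2) * y₂ (Real.pi / 2) < 1) :
    HasOddPeriodicSolution ω γ δ ↔ y₂ (Real.pi / 2) = 0 := by
  have hHK : x₂ (Real.pi / 2) * y₁ (Real.pi / 2) ≠ 0 := by
    have := h.wronskian (Real.pi / 2)
    intro h0
    linarith
  constructor
  · rintro ⟨x, hx, hne, hper, hodd⟩
    have hsys := hx.isInceSystem hε
    have h0 : x 0 = 0 := hodd.map_zero
    have hpi : x Real.pi = 0 := by
      have h1 := hodd Real.pi
      have h2 := hper (-Real.pi)
      rw [show -Real.pi + 2 * Real.pi = Real.pi by ring] at h2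
      linarith
    have hl := h.left_eq hsys
    have hrep := hl Real.pi
    simp only [h0, hpi, zero_mul, zero_add] at hrep hl
    have hv0 : inceCoeff (δ * γ) 0 * deriv x 0 ≠ 0 := fun h0 =>
      hne (funext fun t => by rw [hl t, h0, zero_mul]; rfl)
    have hy := (mul_eq_zero.1 hrep.symm).resolve_left hv0
    rw [h.x₂_pi] at hy
    simpa [left_ne_zero_of_mul hHK] using hy
  · intro hG
    have hshift : ∀ t, x₂ (t + Real.pi) = -x₂ t := fun t => by
      rw [h.add_pi_left h.snd, h.x₂_pi, h.y₂_pi, hG]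
      ring
    refine ⟨x₂, h.snd.isInceSolution hε, fun h0 => ?_, fun t => ?_, fun t => ?_⟩
    · have := h.wronskian 0
      have h2 := (h.snd.left 0).deriv
      rw [h0, h.y₂_zero] at h2
      have h3 : deriv (0 : ℝ → ℝ) 0 = 0 := by simp
      rw [h3] at h2
      exact (inceCoeff_pos hε 0).ne' (by simpa using h2.symm)
    · rw [two_mul, ← add_assoc, hshift, hshift, neg_neg]
    · have := h.left_eq h.snd.neg_arg t
      simp only [neg_zero, h.x₂_zero, h.y₂_zero] at this
      linarith

/-! ### Resonant three-term recurrences and the spectral gap. -/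

/-- `z` solves the three-term recurrence `d j z j + g (z (j + 1) + z (j - 1)) = 0`, closed at
`j = 0` by `g z (-1) = s z 0`. -/
structure IsLadder (d : ℕ → ℝ) (g s : ℝ) (z : ℕ → ℝ) : Prop where
  zero : (d 0 + s) * z 0 + g * z 1 = 0
  succ : ∀ j, d (j + 1) * z (j + 1) + g * (z (j + 2) + z j) = 0

namespace IsLadder

variable {d : ℕ → ℝ} {g s c C : ℝ} {z : ℕ → ℝ} {K : ℕ}

/-- Boundedness excludes the growing solution: the tail supremum S is finite and satisfies c S ≤ |g|
(2 S + |z J|), where 2 |g| S ≤ c S / 4 is absorbed on the left. -/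
lemma tail_le (h : IsLadder d g s z) (hb : ∃ B, ∀ j, |z j| ≤ B) (hc : 0 < c)
    (hg : |g| ≤ c / 8) (hd : ∀ j, K < j → c ≤ |d j|) {J : ℕ} (hJ : K ≤ J) :
    c / 2 * |z (J + 1)| ≤ |g| * |z J| := by
  obtain ⟨B, hB⟩ := hb
  have hbdd : BddAbove (Set.range fun i => |z (J + 1 + i)|) := by
    refine ⟨B, ?_⟩
    rintro _ ⟨i, rfl⟩
    exact hB _
  set S := ⨆ i, |z (J + 1 + i)| with hS
  have hle : ∀ i, |z (J + 1 + i)| ≤ S := fun i => le_ciSup hbdd i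
  have hrec : ∀ j, K ≤ j → c * |z (j + 1)| ≤ |g| * (|z (j + 2)| + |z j|) := fun j hj => by
    have h1 : |d (j + 1) * z (j + 1)| = |g * (z (j + 2) + z j)| := by
      rw [← abs_neg (g * _)]
      congr 1
      linarith [h.succ j]
    rw [abs_mul, abs_mul] at h1
    calc c * |z (j + 1)| ≤ |d (j + 1)| * |z (j + 1)| := by
          gcongr
          exact hd _ (by omega)
      _ = |g| * |z (j + 2) + z j| := h1
      _ ≤ _ := by
          gcongr
          exact abs_add_le _ _
  have hS0 : 0 ≤ S := (abs_nonneg _).trans (hle 0)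
  have hcS : S ≤ |g| * (2 * S + |z J|) / c := by
    refine ciSup_le fun i => ?_
    rw [le_div_iff₀' hc]
    rcases i with _ | i
    · refine (hrec J hJ).trans ?_
      gcongr
      linarith [hle 1]
    · have h2 : |z (J + 1 + i + 2)| ≤ S := hle (i + 2)
      refine (hrec (J + 1 + i) (by omega)).trans (mul_le_mul_of_nonneg_left ?_ (abs_nonneg g))
      linarith [hle i, abs_nonneg (z J)]
  rw [le_div_iff₀' hc] at hcS
  have h0 := hle 0
  have h1 : |g| * S ≤ c / 8 * S := by gcongr
  have h2 : c * |z (J + 1 + 0)| ≤ c * S := by gcongr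
  simp only [add_zero] at h2
  nlinarith [mul_nonneg hc.le hS0]

/-- The closing condition fixes the ratio z 1 / z 0. Going up, the term from the level below is at
most c / 8 times the current one, so the diagonal term dominates and balances g z (j + 1). -/
lemma head_le (h : IsLadder d g s z) (hc : 0 < c) (hs : |s| = |g|) (hg : |g| ≤ c / 8)
    (hd : ∀ j, j < K → c ≤ |d j| ∧ |d j| ≤ C) {j : ℕ} (hj : j < K) :
    c / 2 * |z j| ≤ |g| * |z (j + 1)| ∧ |g| * |z (j + 1)| ≤ 2 * C * |z j| := by
  induction j with
  | zero =>
    have h1 : |g| * |z 1| = |d 0 + s| * |z 0| := by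
      rw [← abs_mul, ← abs_mul, ← abs_neg]
      congr 1
      linarith [h.zero]
    obtain ⟨d1, d2⟩ := hd 0 hj
    have h2 : |d 0 + s| ≤ 2 * C := (abs_add_le _ _).trans (by linarith)
    have h3 : c / 2 ≤ |d 0 + s| := by
      have := abs_sub_abs_le_abs_sub (d 0) (-s)
      rw [abs_neg, sub_neg_eq_add] at this
      linarith
    rw [zero_add, h1]
    constructor <;> gcongr
  | succ j ih =>
    obtain ⟨i1, -⟩ := ih (by omega)
    obtain ⟨d1, d2⟩ := hd (j + 1) hj
    have h1 : |g| * |z (j + 2)| = |d (j + 1) * z (j + 1) + g * z j| := by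
      rw [← abs_mul, ← abs_neg]
      congr 1
      linarith [h.succ j]
    have h2 : |g * z j| ≤ c / 8 * |z (j + 1)| := by
      rw [abs_mul]
      have a1 : |g| * |z j| ≤ c / 8 * |z j| := by gcongr
      have a2 : |g| * |z (j + 1)| ≤ c / 8 * |z (j + 1)| := by gcongr
      linarith [mul_nonneg hc.le (abs_nonneg (z (j + 1)))]
    have h3 := abs_add_le (d (j + 1) * z (j + 1)) (g * z j)
    have h4 := abs_sub_abs_le_abs_sub (d (j + 1) * z (j + 1)) (-(g * z j))
    rw [abs_neg, sub_neg_eq_add] at h4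
    rw [abs_mul (d (j + 1))] at h3 h4
    have h5 := mul_le_mul_of_nonneg_right d1 (abs_nonneg (z (j + 1)))
    have h6 := mul_le_mul_of_nonneg_right d2 (abs_nonneg (z (j + 1)))
    have h7 := mul_nonneg hc.le (abs_nonneg (z (j + 1)))
    rw [show j + 1 + 1 = j + 2 from rfl, h1]
    constructor <;> linarith

/-- Each level climbed contributes exactly one factor g; this produces the exponent in the gap. -/
lemma pow_head_le (h : IsLadder d g s z) (hc : 0 < c) (hC : 0 ≤ C) (hs : |s| = |g|)
    (hg : |g| ≤ c / 8) (hd : ∀ j, j < K → c ≤ |d j| ∧ |d j| ≤ C) {j : ℕ} (hj : j ≤ K) :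
    (c / 2) ^ j * |z 0| ≤ |g| ^ j * |z j| ∧ |g| ^ j * |z j| ≤ (2 * C) ^ j * |z 0| := by
  induction j with
  | zero => simp
  | succ j ih =>
    obtain ⟨i1, i2⟩ := ih (by omega)
    obtain ⟨a1, a2⟩ := h.head_le hc hs hg hd (j := j) (by omega)
    constructor
    · calc (c / 2) ^ (j + 1) * |z 0| = c / 2 * ((c / 2) ^ j * |z 0|) := by ring
        _ ≤ c / 2 * (|g| ^ j * |z j|) := by gcongr
        _ = |g| ^ j * (c / 2 * |z j|) := by ring
        _ ≤ |g| ^ j * (|g| * |z (j + 1)|) := by gcongr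
        _ = _ := by ring
    · calc |g| ^ (j + 1) * |z (j + 1)| = |g| ^ j * (|g| * |z (j + 1)|) := by ring
        _ ≤ |g| ^ j * (2 * C * |z j|) := by gcongr
        _ = 2 * C * (|g| ^ j * |z j|) := by ring
        _ ≤ 2 * C * ((2 * C) ^ j * |z 0|) := by gcongr
        _ = _ := by ring

lemma le_quarter (hc : 0 < c) (hg : |g| ≤ c / 8) {a b : ℝ} (h : c / 2 * |a| ≤ |g| * |b|) :
    |a| ≤ |b| / 4 := by
  have := mul_le_mul_of_nonneg_right hg (abs_nonneg b)
  have h1 : c * |a| ≤ c * (|b| / 4) := by linarith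
  exact le_of_mul_le_mul_left h1 hc

end IsLadder

-- Geometric decay on both sides of K makes the off-peak mass at most half the peak, so Σ z j w j is
-- comparable to z K w K.
open Finset in
lemma sum_peak_le {v : ℕ → ℝ} {K : ℕ} (hv : ∀ j, 0 ≤ v j)
    (hhead : ∀ j, j < K → v j ≤ v (j + 1) / 16) (htail : ∀ j, K ≤ j → v (j + 1) ≤ v j / 16)
    {N : ℕ} (hN : K ≤ N) : ∑ j ∈ (range (N + 1)).erase K, v j ≤ v K / 2 := by
  have h1 : ∀ n, n ≤ K → ∑ j ∈ range n, v j ≤ v n / 4 := by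
    intro n hn
    induction n with
    | zero => simpa using by linarith [hv 0]
    | succ n ih =>
      rw [sum_range_succ]
      linarith [ih (by omega), hhead n (by omega), hv (n + 1)]
  -- The last summand telescopes, since v (n + 1) ≤ (v n - v (n + 1)) / 4.
  have h2 : ∀ n, K ≤ n → ∑ j ∈ range (n + 1), v j ≤ v K / 4 + v K + (v K - v n) / 4 := by
    intro n hn
    induction n, hn using Nat.le_induction with
    | base =>
      rw [sum_range_succ]
      linarith [h1 K le_rfl]
    | succ n hn ih =>
      rw [sum_range_succ]
      linarith [htail n hn, hv n]
  have h3 := add_sum_erase (range (N + 1)) v (mem_range.2 (Nat.lt_succ_of_le hN))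
  linarith [h2 N hN, hv N]

/-- Disposes of the boundary term at N in the Lagrange identity. -/
lemma eventually_small_of_decay {v : ℕ → ℝ} {K : ℕ}
    (htail : ∀ j, K ≤ j → v (j + 1) ≤ v j / 16) {e : ℝ} (he : 0 < e) : ∃ N, K ≤ N ∧ v N ≤ e := by
  have h : ∀ i, v (K + i) ≤ v K * (1 / 16) ^ i := by
    intro i
    induction i with
    | zero => simp
    | succ i ih =>
      have := htail (K + i) (by omega)
      rw [← add_assoc, pow_succ]
      linarith
  have hlim : Filter.Tendsto (fun i : ℕ => v K * (1 / 16 : ℝ) ^ i) Filter.atTop (𝓝 (v K * 0)) :=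
    (tendsto_pow_atTop_nhds_zero_of_lt_one (by norm_num) (by norm_num)).const_mul _
  rw [mul_zero] at hlim
  obtain ⟨i, hi⟩ := (hlim.eventually_lt_const he).exists
  exact ⟨K + i, by omega, (h i).trans hi.le⟩

open Finset in
/-- Discrete Lagrange identity for two ladders with opposite closing conditions. -/
lemma IsLadder.lagrange {κ : ℕ → ℝ} {θ θ' g : ℝ} {z w : ℕ → ℝ}
    (hz : IsLadder (fun j => θ - κ j) g (-g) z) (hw : IsLadder (fun j => θ' - κ j) g g w)
    (N : ℕ) :
    (θ - θ') * ∑ j ∈ range (N + 1), z j * w j + g * (z (N + 1) * w N - w (N + 1) * z N) =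
      2 * g * (z 0 * w 0) := by
  induction N with
  | zero =>
    simp only [zero_add, range_one, sum_singleton]
    linear_combination w 0 * hz.zero - z 0 * hw.zero
  | succ N ih =>
    rw [sum_range_succ]
    linear_combination ih + w (N + 1) * hz.succ N - z (N + 1) * hw.succ N

/-- The gap between the spectral parameters of two ladders which are closed at the bottom with
opposite signs and resonate at the level `K` is of exact order `g ^ (2 K + 1)`. -/
theorem IsLadder.gap {κ : ℕ → ℝ} {θ θ' g c C : ℝ} {z w : ℕ → ℝ} {K : ℕ}
    (hz : IsLadder (fun j => θ - κ j) g (-g) z) (hw : IsLadder (fun j => θ' - κ j) g g w)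
    (hzb : ∃ B, ∀ j, |z j| ≤ B) (hwb : ∃ B, ∀ j, |w j| ≤ B) (hzK : z K ≠ 0) (hwK : w K ≠ 0)
    (hc : 0 < c) (hC : 0 ≤ C) (hg : |g| ≤ c / 8)
    (hθ : ∀ j, j ≠ K → c ≤ |θ - κ j| ∧ |θ - κ j| ≤ C)
    (hθ' : ∀ j, j ≠ K → c ≤ |θ' - κ j| ∧ |θ' - κ j| ≤ C) :
    |θ - θ'| * (c / 2) ^ (2 * K) ≤ 4 * |g| ^ (2 * K + 1) ∧
      |g| ^ (2 * K + 1) ≤ (2 * C) ^ (2 * K) * |θ - θ'| := by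
  set v : ℕ → ℝ := fun j => |z j * w j| with hv
  have hv0 : ∀ j, 0 ≤ v j := fun j => abs_nonneg _
  have hzh := fun j (hj : j < K) => IsLadder.le_quarter hc hg
    (hz.head_le (K := K) hc (abs_neg g) hg (fun j hj => hθ j hj.ne) hj).1
  have hwh := fun j (hj : j < K) => IsLadder.le_quarter hc hg
    (hw.head_le (K := K) hc rfl hg (fun j hj => hθ' j hj.ne) hj).1
  have hzt := fun j (hj : K ≤ j) => IsLadder.le_quarter hc hg
    (hz.tail_le hzb hc hg (fun j hj => (hθ j hj.ne').1) hj)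
  have hwt := fun j (hj : K ≤ j) => IsLadder.le_quarter hc hg
    (hw.tail_le hwb hc hg (fun j hj => (hθ' j hj.ne').1) hj)
  have hhead : ∀ j, j < K → v j ≤ v (j + 1) / 16 := fun j hj => by
    simp only [hv, abs_mul]
    calc |z j| * |w j| ≤ |z (j + 1)| / 4 * (|w (j + 1)| / 4) :=
          mul_le_mul (hzh j hj) (hwh j hj) (abs_nonneg _) (by positivity)
      _ = _ := by ring
  have htail : ∀ j, K ≤ j → v (j + 1) ≤ v j / 16 := fun j hj => by
    simp only [hv, abs_mul]
    calc |z (j + 1)| * |w (j + 1)| ≤ |z j| / 4 * (|w j| / 4) :=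
          mul_le_mul (hzt j hj) (hwt j hj) (abs_nonneg _) (by positivity)
      _ = _ := by ring
  have hvK : 0 < v K := abs_pos.2 (mul_ne_zero hzK hwK)
  have hsum : ∀ N, K ≤ N → v K / 2 ≤ |∑ j ∈ Finset.range (N + 1), z j * w j| ∧
      |∑ j ∈ Finset.range (N + 1), z j * w j| ≤ 2 * v K := fun N hN => by
    have h1 := Finset.add_sum_erase (Finset.range (N + 1)) (fun j => z j * w j)
      (Finset.mem_range.2 (Nat.lt_succ_of_le hN))
    have h2 := (Finset.abs_sum_le_sum_abs (fun j => z j * w j) _).trans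
      (sum_peak_le hv0 hhead htail hN)
    rw [← h1]
    have h3 := abs_add_le (z K * w K) (∑ j ∈ (Finset.range (N + 1)).erase K, z j * w j)
    have h4 := abs_sub_abs_le_abs_sub (z K * w K)
      (-∑ j ∈ (Finset.range (N + 1)).erase K, z j * w j)
    rw [abs_neg, sub_neg_eq_add] at h4
    change v K - _ ≤ _ at h4
    change _ ≤ v K + _ at h3
    constructor <;> linarith
  have hT : ∀ N, K ≤ N → |g * (z (N + 1) * w N - w (N + 1) * z N)| ≤ |g| * v N := fun N hN => by
    rw [abs_mul]
    gcongr
    calc |z (N + 1) * w N - w (N + 1) * z N| ≤ |z (N + 1)| * |w N| + |w (N + 1)| * |z N| := by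
          rw [← abs_mul, ← abs_mul]
          exact abs_sub _ _
      _ ≤ |z N| / 4 * |w N| + |w N| / 4 * |z N| := by
          gcongr
          exacts [hzt N hN, hwt N hN]
      _ ≤ v N := by
          simp only [hv, abs_mul]
          nlinarith [mul_nonneg (abs_nonneg (z N)) (abs_nonneg (w N))]
  have habs : |2 * g * (z 0 * w 0)| = 2 * |g| * v 0 := by
    rw [abs_mul, abs_mul, abs_two]
  -- With N large the boundary term drops below any e, leaving |θ - θ'| times a sum between v K / 2
  -- and 2 v K against 2 |g| v 0.
  have hup : |θ - θ'| * (v K / 2) ≤ 2 * |g| * v 0 := by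
    refine le_of_forall_pos_le_add fun e he => ?_
    obtain ⟨N, hN, hNe⟩ := eventually_small_of_decay htail
      (show 0 < e / (|g| + 1) by positivity)
    rw [le_div_iff₀ (by positivity)] at hNe
    have h1 := hz.lagrange hw N
    have h2 : |(θ - θ') * ∑ j ∈ Finset.range (N + 1), z j * w j| ≤ 2 * |g| * v 0 + |g| * v N := by
      rw [eq_sub_of_add_eq h1, ← habs]
      exact (abs_sub _ _).trans (by gcongr; exact hT N hN)
    rw [abs_mul] at h2
    have h3 := mul_le_mul_of_nonneg_left (hsum N hN).1 (abs_nonneg (θ - θ'))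
    linarith [hv0 N]
  have hlow : 2 * |g| * v 0 ≤ |θ - θ'| * (2 * v K) := by
    refine le_of_forall_pos_le_add fun e he => ?_
    obtain ⟨N, hN, hNe⟩ := eventually_small_of_decay htail
      (show 0 < e / (|g| + 1) by positivity)
    rw [le_div_iff₀ (by positivity)] at hNe
    rw [← habs, ← hz.lagrange hw N]
    refine (abs_add_le _ _).trans ?_
    rw [abs_mul]
    have h3 := mul_le_mul_of_nonneg_left (hsum N hN).2 (abs_nonneg (θ - θ'))
    linarith [hT N hN, hv0 N]
  obtain ⟨z1, z2⟩ := hz.pow_head_le (K := K) hc hC (abs_neg g) hg (fun j hj => hθ j hj.ne) le_rfl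
  obtain ⟨w1, w2⟩ := hw.pow_head_le (K := K) hc hC rfl hg (fun j hj => hθ' j hj.ne) le_rfl
  -- Both ladders are climbed from 0 to K, which exchanges v 0 for |g|^(2K) v K up to constants.
  have e1 : (c / 2) ^ (2 * K) * v 0 ≤ |g| ^ (2 * K) * v K := by
    simp only [hv, abs_mul]
    calc (c / 2) ^ (2 * K) * (|z 0| * |w 0|)
        = ((c / 2) ^ K * |z 0|) * ((c / 2) ^ K * |w 0|) := by ring
      _ ≤ (|g| ^ K * |z K|) * (|g| ^ K * |w K|) := by gcongr
      _ = _ := by ring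
  have e2 : |g| ^ (2 * K) * v K ≤ (2 * C) ^ (2 * K) * v 0 := by
    simp only [hv, abs_mul]
    calc |g| ^ (2 * K) * (|z K| * |w K|) = (|g| ^ K * |z K|) * (|g| ^ K * |w K|) := by ring
      _ ≤ ((2 * C) ^ K * |z 0|) * ((2 * C) ^ K * |w 0|) := by gcongr
      _ = _ := by ring
  constructor
  · refine le_of_mul_le_mul_right ?_ hvK
    calc |θ - θ'| * (c / 2) ^ (2 * K) * v K
        = 2 * (c / 2) ^ (2 * K) * (|θ - θ'| * (v K / 2)) := by ring
      _ ≤ 2 * (c / 2) ^ (2 * K) * (2 * |g| * v 0) := by gcongr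
      _ = 4 * |g| * ((c / 2) ^ (2 * K) * v 0) := by ring
      _ ≤ 4 * |g| * (|g| ^ (2 * K) * v K) := by gcongr
      _ = _ := by ring
  · refine le_of_mul_le_mul_right ?_ hvK
    calc |g| ^ (2 * K + 1) * v K = |g| * (|g| ^ (2 * K) * v K) := by ring
      _ ≤ |g| * ((2 * C) ^ (2 * K) * v 0) := by gcongr
      _ = (2 * C) ^ (2 * K) * (2 * |g| * v 0) / 2 := by ring
      _ ≤ (2 * C) ^ (2 * K) * (|θ - θ'| * (2 * v K)) / 2 := by gcongr
      _ = _ := by ring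

/-! ### Analytic dependence on parameters through a weighted Volterra equation. -/

open scoped BoundedContinuousFunction

lemma isUnit_one_add_of_norm_lt_one {A : Type*} [NormedRing A] [CompleteSpace A] {a : A}
    (h : ‖a‖ < 1) : IsUnit (1 + a) := by
  have := isUnit_one_sub_of_norm_lt_one (x := -a) (by rwa [norm_neg])
  rwa [sub_neg_eq_add] at this

section

variable {E : Type*} [NormedRing E] [NormedAlgebra ℝ E]

/-- The operator `X ↦ X + l J (q J X)` on a Banach algebra. -/
noncomputable def sandwich (J : E →L[ℝ] E) (q : E) (l : ℝ) : E →L[ℝ] E :=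
  1 + l • (J * ContinuousLinearMap.mul ℝ E q * J)

lemma analyticAt_sandwich (J : E →L[ℝ] E) {F : Type*} [NormedAddCommGroup F] [NormedSpace ℝ F]
    {q : F → E} {l : F → ℝ} {p : F} (hq : AnalyticAt ℝ q p) (hl : AnalyticAt ℝ l p) :
    AnalyticAt ℝ (fun p => sandwich J (q p) (l p)) p := by
  have h2 : AnalyticAt ℝ (fun p => ContinuousLinearMap.mul ℝ E (q p)) p :=
    (ContinuousLinearMap.analyticAt _ _).comp hq
  exact analyticAt_const.add (hl.smul ((analyticAt_const.mul h2).mul analyticAt_const))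

lemma sandwich_inverse_apply {J : E →L[ℝ] E} {q : E} {l : ℝ} (hu : IsUnit (sandwich J q l))
    (f : E) :
    Ring.inverse (sandwich J q l) f + l • J (q * J (Ring.inverse (sandwich J q l) f)) = f :=
  congrArg (fun T : E →L[ℝ] E => T f) (Ring.mul_inverse_cancel _ hu)

variable [CompleteSpace E]

/-- Neumann series. Only q = 1, that is ε = 0, is needed, since units form an open set. -/
lemma isUnit_sandwich_one (J : E →L[ℝ] E) {l : ℝ} (hl : |l| * ‖J‖ ^ 2 < 1) :
    IsUnit (sandwich J 1 l) := by
  have h1 : ContinuousLinearMap.mul ℝ E 1 = 1 := by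
    ext f
    simp
  unfold sandwich
  rw [h1, mul_one]
  refine isUnit_one_add_of_norm_lt_one (lt_of_le_of_lt ?_ hl)
  rw [norm_smul, Real.norm_eq_abs, sq]
  gcongr
  exact norm_mul_le _ _

lemma analyticAt_sandwich_inverse_apply {F : Type*} [NormedAddCommGroup F] [NormedSpace ℝ F]
    {J : E →L[ℝ] E} {q : F → E} {l : F → ℝ} {p : F} (hq : AnalyticAt ℝ q p)
    (hl : AnalyticAt ℝ l p) (hu : IsUnit (sandwich J (q p) (l p))) (f : E) :
    AnalyticAt ℝ (fun p => Ring.inverse (sandwich J (q p) (l p)) f) p := by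
  have h1 : AnalyticAt ℝ (fun p => Ring.inverse (sandwich J (q p) (l p))) p := by
    obtain ⟨u, hu⟩ := hu
    have h1 := analyticAt_inverse (𝕜 := ℝ) u
    rw [hu] at h1
    exact AnalyticAt.comp (f := fun p => sandwich J (q p) (l p)) h1 (analyticAt_sandwich J hq hl)
  exact (ContinuousLinearMap.analyticAt (ContinuousLinearMap.apply ℝ E f) _).comp h1

lemma eventually_isUnit_sandwich {F : Type*} [NormedAddCommGroup F] [NormedSpace ℝ F]
    {J : E →L[ℝ] E} {q : F → E} {l : F → ℝ} {p : F} (hq : AnalyticAt ℝ q p)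
    (hl : AnalyticAt ℝ l p) (hu : IsUnit (sandwich J (q p) (l p))) :
    ∀ᶠ p in 𝓝 p, IsUnit (sandwich J (q p) (l p)) :=
  (analyticAt_sandwich J hq hl).continuousAt.eventually (Units.isOpen.mem_nhds hu)

end

/-- The primitive of cosh Ls is sinh Ls / L and |sinh| ≤ cosh. The weight thus gives integration
norm at most 1/L on the whole line, small for large L. -/
lemma abs_integral_cosh_mul_le {L : ℝ} (hL : 0 < L) (f : ℝ →ᵇ ℝ) (t : ℝ) :
    |∫ s in (0 : ℝ)..t, Real.cosh (L * s) * f s| ≤ ‖f‖ / L * Real.cosh (L * t) := by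
  have hint : ∫ s in (0 : ℝ)..t, Real.cosh (L * s) * ‖f‖ = ‖f‖ / L * Real.sinh (L * t) := by
    rw [intervalIntegral.integral_eq_sub_of_hasDerivAt (E := ℝ)
      (f := fun s => ‖f‖ / L * Real.sinh (L * s))]
    · simp
    · intro s _
      have h1 : HasDerivAt (fun s => L * s) L s := by simpa using (hasDerivAt_id s).const_mul L
      refine ((Real.hasDerivAt_sinh _).comp s h1 |>.const_mul (‖f‖ / L)).congr_deriv ?_
      field_simp
    · exact Continuous.intervalIntegrable (by fun_prop) _ _
  have hle : |∫ s in (0 : ℝ)..t, Real.cosh (L * s) * f s| ≤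
      |∫ s in (0 : ℝ)..t, Real.cosh (L * s) * ‖f‖| := by
    rw [← Real.norm_eq_abs]
    refine intervalIntegral.norm_integral_le_abs_of_norm_le ?_ ?_
    · refine Filter.Eventually.of_forall fun s => ?_
      rw [norm_mul, Real.norm_of_nonneg (Real.cosh_pos _).le]
      exact mul_le_mul_of_nonneg_left (f.norm_coe_le_norm s) (Real.cosh_pos _).le
    · exact Continuous.intervalIntegrable (by fun_prop) _ _
  refine hle.trans ?_
  rw [hint, abs_mul, abs_of_nonneg (by positivity : 0 ≤ ‖f‖ / L)]
  refine mul_le_mul_of_nonneg_left ?_ (by positivity)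
  rw [← abs_of_pos (Real.cosh_pos (L * t))]
  refine sq_le_sq.1 ?_
  linarith [Real.cosh_sq (L * t)]

/-- The primitive `f ↦ (cosh Lt)⁻¹ ∫₀ᵗ cosh Ls f(s) ds`, conjugated by the weight `cosh Lt`, as an
operator on bounded continuous functions. -/
noncomputable def weightedPrimitive (L : ℝ) (hL : 0 < L) : (ℝ →ᵇ ℝ) →L[ℝ] (ℝ →ᵇ ℝ) :=
  LinearMap.mkContinuous
    { toFun := fun f => BoundedContinuousFunction.ofNormedAddCommGroup
        (fun t => (∫ s in (0 : ℝ)..t, Real.cosh (L * s) * f s) / Real.cosh (L * t))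
        (by
          have h1 : Continuous fun t => ∫ s in (0 : ℝ)..t, Real.cosh (L * s) * f s :=
            intervalIntegral.continuous_primitive
              (fun a b => Continuous.intervalIntegrable (by fun_prop) a b) 0
          exact h1.div (by fun_prop) fun t => (Real.cosh_pos _).ne')
        (‖f‖ / L)
        (fun t => by
          rw [norm_div, Real.norm_of_nonneg (Real.cosh_pos _).le, div_le_iff₀ (Real.cosh_pos _)]
          exact abs_integral_cosh_mul_le hL f t)
      map_add' := fun f g => by
        ext t
        have h : ∀ f : ℝ →ᵇ ℝ, IntervalIntegrable (fun s => Real.cosh (L * s) * f s)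
          MeasureTheory.volume 0 t := fun f => Continuous.intervalIntegrable (by fun_prop) _ _
        simp only [BoundedContinuousFunction.coe_ofNormedAddCommGroup,
          BoundedContinuousFunction.coe_add, Pi.add_apply, mul_add]
        rw [intervalIntegral.integral_add (h f) (h g), add_div]
      map_smul' := fun c f => by
        ext t
        simp only [BoundedContinuousFunction.coe_ofNormedAddCommGroup,
          BoundedContinuousFunction.coe_smul, smul_eq_mul, RingHom.id_apply, mul_left_comm _ c]
        rw [intervalIntegral.integral_const_mul, mul_div_assoc] }
    (1 / L)
    (fun f => by
      rw [one_div, inv_mul_eq_div]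
      exact BoundedContinuousFunction.norm_ofNormedAddCommGroup_le _ (by positivity)
        fun t => by
          rw [norm_div, Real.norm_of_nonneg (Real.cosh_pos _).le, div_le_iff₀ (Real.cosh_pos _)]
          exact abs_integral_cosh_mul_le hL f t)

lemma cosh_mul_weightedPrimitive {L : ℝ} (hL : 0 < L) (f : ℝ →ᵇ ℝ) (t : ℝ) :
    Real.cosh (L * t) * weightedPrimitive L hL f t =
      ∫ s in (0 : ℝ)..t, Real.cosh (L * s) * f s :=
  mul_div_cancel₀ _ (Real.cosh_pos _).ne'

lemma norm_weightedPrimitive_le {L : ℝ} (hL : 0 < L) : ‖weightedPrimitive L hL‖ ≤ 1 / L :=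
  LinearMap.mkContinuous_norm_le _ (by positivity) _

/-- `t ↦ cos (n t)` as a bounded continuous function. -/
noncomputable def boundedCos (n : ℝ) : ℝ →ᵇ ℝ :=
  BoundedContinuousFunction.ofNormedAddCommGroup (fun t => Real.cos (n * t)) (by fun_prop) 1
    fun t => Real.abs_cos_le_one _

/-- `t ↦ (cosh Lt)⁻¹` as a bounded continuous function. -/
noncomputable def boundedSech (L : ℝ) : ℝ →ᵇ ℝ :=
  BoundedContinuousFunction.ofNormedAddCommGroup (fun t => (Real.cosh (L * t))⁻¹)
    (Continuous.inv₀ (by fun_prop) fun t => (Real.cosh_pos _).ne') 1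
    fun t => by
      rw [norm_inv, Real.norm_of_nonneg (Real.cosh_pos _).le]
      exact inv_le_one_of_one_le₀ (Real.one_le_cosh _)

/-- The reciprocal of the leading coefficient as a bounded continuous function. -/
noncomputable def invInceCoeff (ε : ℝ) : ℝ →ᵇ ℝ := Ring.inverse (1 + ε • boundedCos 2)

lemma invInceCoeff_apply {ε : ℝ} (hε : |ε| < 1) (t : ℝ) :
    invInceCoeff ε t = (inceCoeff ε t)⁻¹ := by
  have hcos : ‖boundedCos 2‖ ≤ 1 :=
    BoundedContinuousFunction.norm_ofNormedAddCommGroup_le _ zero_le_one _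
  have hu : IsUnit (1 + ε • boundedCos 2) := by
    refine isUnit_one_add_of_norm_lt_one ?_
    rw [norm_smul]
    exact (mul_le_of_le_one_right (norm_nonneg _) hcos).trans_lt hε
  have h := congrArg (fun f : ℝ →ᵇ ℝ => f t) (Ring.inverse_mul_cancel _ hu)
  exact eq_inv_of_mul_eq_one_left h

lemma analyticAt_invInceCoeff : AnalyticAt ℝ invInceCoeff 0 := by
  have h1 : AnalyticAt ℝ (fun ε : ℝ => 1 + ε • boundedCos 2) 0 := by fun_prop
  have h2 : AnalyticAt ℝ (Ring.inverse : (ℝ →ᵇ ℝ) → (ℝ →ᵇ ℝ)) (1 + (0 : ℝ) • boundedCos 2) := by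
    rw [zero_smul, add_zero]
    exact analyticAt_inverse (1 : (ℝ →ᵇ ℝ)ˣ)
  exact AnalyticAt.comp (f := fun ε : ℝ => 1 + ε • boundedCos 2) h2 h1

lemma analyticAt_invInceCoeff_fst (l : ℝ) :
    AnalyticAt ℝ (fun p : ℝ × ℝ => invInceCoeff p.1) (0, l) :=
  AnalyticAt.comp (g := invInceCoeff) (f := fun p : ℝ × ℝ => p.1)
    (x := ((0 : ℝ), l)) analyticAt_invInceCoeff analyticAt_fst

/-- The Volterra operator `X ↦ X + l J (q J X)`, with `q` the reciprocal leading coefficient. -/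
noncomputable abbrev inceVolterra (L : ℝ) (hL : 0 < L) (p : ℝ × ℝ) :
    (ℝ →ᵇ ℝ) →L[ℝ] (ℝ →ᵇ ℝ) :=
  sandwich (weightedPrimitive L hL) (invInceCoeff p.1) p.2

lemma isUnit_inceVolterra {L l : ℝ} (hL : 0 < L) (hl : |l| < L ^ 2) :
    IsUnit (inceVolterra L hL (0, l)) := by
  have h1 : invInceCoeff 0 = 1 := by simp [invInceCoeff]
  have hJ := norm_weightedPrimitive_le hL
  simp only [inceVolterra, h1]
  refine isUnit_sandwich_one _ ?_
  calc |l| * ‖weightedPrimitive L hL‖ ^ 2 ≤ |l| * (1 / L) ^ 2 := by gcongr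
    _ = |l| / L ^ 2 := by ring
    _ < 1 := (div_lt_one (by positivity)).2 hl

/-- The solution with initial values `(α, β)`, divided by `cosh Lt`. -/
noncomputable def inceState (L : ℝ) (hL : 0 < L) (α β : ℝ) (p : ℝ × ℝ) : ℝ →ᵇ ℝ :=
  Ring.inverse (inceVolterra L hL p)
    (α • boundedSech L + β • weightedPrimitive L hL (invInceCoeff p.1 * boundedSech L))

/-- First component of the solution with initial values `(α, β)`. -/
noncomputable def inceX (L : ℝ) (hL : 0 < L) (α β : ℝ) (p : ℝ × ℝ) (t : ℝ) : ℝ :=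
  Real.cosh (L * t) * inceState L hL α β p t

/-- Second component of the solution with initial values `(α, β)`. -/
noncomputable def inceY (L : ℝ) (hL : 0 < L) (α β : ℝ) (p : ℝ × ℝ) (t : ℝ) : ℝ :=
  β - p.2 * ∫ s in (0 : ℝ)..t, inceX L hL α β p s

section

variable {L : ℝ} {hL : 0 < L} {α β : ℝ} {p : ℝ × ℝ}

lemma continuous_inceX : Continuous (inceX L hL α β p) := by
  unfold inceX
  fun_prop

lemma hasDerivAt_inceY (t : ℝ) :
    HasDerivAt (inceY L hL α β p) (-p.2 * inceX L hL α β p t) t := by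
  have := (((continuous_inceX (L := L) (hL := hL) (α := α) (β := β)
    (p := p)).integral_hasStrictDerivAt 0 t).hasDerivAt.const_mul p.2).const_sub β
  exact this.congr_deriv (by ring)

lemma continuous_inceY : Continuous (inceY L hL α β p) :=
  continuous_iff_continuousAt.2 fun t => (hasDerivAt_inceY t).continuousAt

/-- Multiplication by cosh Lt undoes the weight and turns the operator equation into the integrated
form of the system. -/
lemma inceX_eq (hε : |p.1| < 1) (hu : IsUnit (inceVolterra L hL p)) (t : ℝ) :
    inceX L hL α β p t =
      α + ∫ s in (0 : ℝ)..t, inceY L hL α β p s / inceCoeff p.1 s := by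
  set X := inceState L hL α β p with hX
  set J := weightedPrimitive L hL with hJ
  set q := invInceCoeff p.1 with hq
  have hs : ∀ s, Real.cosh (L * s) * boundedSech L s = 1 := fun s =>
    mul_inv_cancel₀ (Real.cosh_pos _).ne'
  have h1 : X + p.2 • J (q * J X) = α • boundedSech L + β • J (q * boundedSech L) :=
    sandwich_inverse_apply hu _
  have h2 := congrArg (fun f : ℝ →ᵇ ℝ => Real.cosh (L * t) * f t) h1
  have e1 : ∫ s in (0 : ℝ)..t, Real.cosh (L * s) * (q * J X) s =
      ∫ s in (0 : ℝ)..t, (∫ r in (0 : ℝ)..s, inceX L hL α β p r) / inceCoeff p.1 s := by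
    refine intervalIntegral.integral_congr fun s _ => ?_
    have := cosh_mul_weightedPrimitive hL X s
    simp only [BoundedContinuousFunction.mul_apply, hq, invInceCoeff_apply hε, inceX, ← hX,
      ← this, ← hJ]
    ring
  have e2 : ∫ s in (0 : ℝ)..t, Real.cosh (L * s) * (q * boundedSech L) s =
      ∫ s in (0 : ℝ)..t, 1 / inceCoeff p.1 s := by
    refine intervalIntegral.integral_congr fun s _ => ?_
    simp only [BoundedContinuousFunction.mul_apply, hq, invInceCoeff_apply hε]
    linear_combination (inceCoeff p.1 s)⁻¹ * hs s
  have e3 : ∫ s in (0 : ℝ)..t, inceY L hL α β p s / inceCoeff p.1 s =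
      β * (∫ s in (0 : ℝ)..t, 1 / inceCoeff p.1 s) -
        p.2 * ∫ s in (0 : ℝ)..t, (∫ r in (0 : ℝ)..s, inceX L hL α β p r) / inceCoeff p.1 s := by
    have hc := continuous_inceCoeff p.1
    have hne : ∀ s, inceCoeff p.1 s ≠ 0 := fun s => (inceCoeff_pos hε s).ne'
    have hI : Continuous fun s => ∫ r in (0 : ℝ)..s, inceX L hL α β p r :=
      intervalIntegral.continuous_primitive
        (fun a b => continuous_inceX.intervalIntegrable a b) 0
    rw [← intervalIntegral.integral_const_mul, ← intervalIntegral.integral_const_mul,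
      ← intervalIntegral.integral_sub
        (f := fun s => β * (1 / inceCoeff p.1 s))
        (g := fun s => p.2 * ((∫ r in (0 : ℝ)..s, inceX L hL α β p r) / inceCoeff p.1 s))
        (Continuous.intervalIntegrable ((continuous_const.div hc hne).const_mul β) _ _)
        (Continuous.intervalIntegrable ((hI.div hc hne).const_mul p.2) _ _)]
    refine intervalIntegral.integral_congr fun s _ => ?_
    simp only [inceY]
    ring
  simp only [BoundedContinuousFunction.add_apply, BoundedContinuousFunction.smul_apply,
    smul_eq_mul, mul_add, mul_left_comm (Real.cosh (L * t)), hs, hJ,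
    cosh_mul_weightedPrimitive] at h2
  rw [← hJ, e1, e2] at h2
  rw [e3, inceX, ← hX]
  linarith

lemma isInceSystem_inceX (hε : |p.1| < 1) (hu : IsUnit (inceVolterra L hL p)) :
    IsInceSystem p.1 p.2 (inceX L hL α β p) (inceY L hL α β p) where
  left t := by
    have hc : Continuous fun s => inceY L hL α β p s / inceCoeff p.1 s :=
      continuous_inceY.div (continuous_inceCoeff _) fun s => (inceCoeff_pos hε s).ne'
    have := ((hc.integral_hasStrictDerivAt 0 t).hasDerivAt).const_add α
    rwa [← funext (inceX_eq hε hu)] at this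
  right := hasDerivAt_inceY

lemma inceX_zero (hε : |p.1| < 1) (hu : IsUnit (inceVolterra L hL p)) :
    inceX L hL α β p 0 = α := by
  simp [inceX_eq hε hu]

lemma inceY_zero : inceY L hL α β p 0 = β := by
  simp [inceY]

end

/-- Near `ε = 0` the Ince equation has a fundamental pair of solutions, the first of which depends
analytically on the parameters. -/
theorem exists_isInceFundamental (l : ℝ) :
    ∃ x₁ y₁ x₂ y₂ : ℝ × ℝ → ℝ → ℝ,
      (∀ᶠ p in 𝓝 ((0 : ℝ), l),
        |p.1| < 1 ∧ IsInceFundamental p.1 p.2 (x₁ p) (y₁ p) (x₂ p) (y₂ p)) ∧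
      AnalyticAt ℝ (fun p => x₁ p (Real.pi / 2)) (0, l) ∧
      ∀ n : ℝ, ContinuousAt
        (fun p => ∫ t in (0 : ℝ)..Real.pi / 2, x₁ p t * Real.cos (n * t)) (0, l) := by
  have hL : 0 < |l| + 1 := by positivity
  -- This choice gives |l| < L², so the Volterra operator is invertible at ε = 0.
  set L := |l| + 1 with hLdef
  have hl : |l| < L ^ 2 := by nlinarith [abs_nonneg l]
  have hunit := isUnit_inceVolterra hL hl
  have hq := analyticAt_invInceCoeff_fst l
  have hst : AnalyticAt ℝ (inceState L hL 1 0) (0, l) := by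
    have h2 := analyticAt_sandwich_inverse_apply hq analyticAt_snd hunit (boundedSech L)
    have h3 : inceState L hL 1 0 = fun p =>
        Ring.inverse (inceVolterra L hL p) (boundedSech L) := by
      funext p
      simp [inceState]
    rw [h3]
    exact h2
  refine ⟨inceX L hL 1 0, inceY L hL 1 0, inceX L hL 0 1, inceY L hL 0 1, ?_, ?_, fun n => ?_⟩
  · have h1 : ∀ᶠ p : ℝ × ℝ in 𝓝 (0, l), |p.1| < 1 :=
      (continuous_fst.abs.continuousAt).eventually_lt_const (by simp)
    have h2 : ∀ᶠ p : ℝ × ℝ in 𝓝 (0, l), IsUnit (inceVolterra L hL p) :=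
      eventually_isUnit_sandwich hq analyticAt_snd hunit
    filter_upwards [h1, h2] with p hp hu
    exact ⟨hp, isInceSystem_inceX hp hu, isInceSystem_inceX hp hu, inceX_zero hp hu, inceY_zero,
      inceX_zero hp hu, inceY_zero⟩
  · exact analyticAt_const.mul ((ContinuousLinearMap.analyticAt
      (BoundedContinuousFunction.evalCLM ℝ (Real.pi / 2) : (ℝ →ᵇ ℝ) →L[ℝ] ℝ) _).comp hst)
  -- The coefficient is a continuous linear functional of the weighted solution.
  · have h1 : (fun p => ∫ t in (0 : ℝ)..Real.pi / 2, inceX L hL 1 0 p t * Real.cos (n * t)) =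
        fun p => Real.cosh (L * (Real.pi / 2)) *
          weightedPrimitive L hL (inceState L hL 1 0 p * boundedCos n) (Real.pi / 2) := by
      funext p
      rw [cosh_mul_weightedPrimitive]
      refine intervalIntegral.integral_congr fun s _ => ?_
      exact mul_assoc _ _ _
    rw [h1]
    have h2 : ContinuousAt (fun p => weightedPrimitive L hL (inceState L hL 1 0 p * boundedCos n))
        (0, l) :=
      (weightedPrimitive L hL).continuous.continuousAt.comp
        (hst.continuousAt.mul continuousAt_const)
    exact continuousAt_const.mul
      ((BoundedContinuousFunction.evalCLM ℝ (Real.pi / 2)).continuous.continuousAt.comp h2)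

/-! ### Fourier coefficients of the even solution. -/

/-- The Fourier coefficient of `x'` on the quarter period, up to sign. -/
noncomputable def inceCoefficient (x : ℝ → ℝ) (n : ℝ) : ℝ :=
  n * ∫ t in (0 : ℝ)..Real.pi / 2, x t * Real.cos (n * t)

lemma inceCoefficient_neg (x : ℝ → ℝ) (n : ℝ) : inceCoefficient x (-n) = -inceCoefficient x n := by
  simp [inceCoefficient]

lemma hasDerivAt_cos_mul (n t : ℝ) :
    HasDerivAt (fun t => Real.cos (n * t)) (-(n * Real.sin (n * t))) t := by
  have h : HasDerivAt (fun t => n * t) n t := by simpa using (hasDerivAt_id t).const_mul n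
  exact h.cos.congr_deriv (by ring)

lemma hasDerivAt_sin_mul (n t : ℝ) :
    HasDerivAt (fun t => Real.sin (n * t)) (n * Real.cos (n * t)) t := by
  have h : HasDerivAt (fun t => n * t) n t := by simpa using (hasDerivAt_id t).const_mul n
  exact h.sin.congr_deriv (by ring)

namespace IsInceSystem

variable {ε l : ℝ} {x y : ℝ → ℝ}

lemma continuous_deriv (h : IsInceSystem ε l x y) (hε : |ε| < 1) :
    Continuous fun t => y t / inceCoeff ε t :=
  h.continuous_right.div (continuous_inceCoeff ε) fun t => (inceCoeff_pos hε t).ne'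

lemma integral_deriv_mul_sin (h : IsInceSystem ε l x y) (hε : |ε| < 1)
    (hx : x (Real.pi / 2) = 0) (n : ℝ) :
    ∫ t in (0 : ℝ)..Real.pi / 2, y t / inceCoeff ε t * Real.sin (n * t) =
      -inceCoefficient x n := by
  have hc := h.continuous_deriv hε
  have hxc := h.continuous_left
  have := intervalIntegral.integral_deriv_mul_eq_sub (a := 0) (b := Real.pi / 2)
    (fun t _ => h.left t) (fun t _ => hasDerivAt_sin_mul n t) (hc.intervalIntegrable _ _)
    (Continuous.intervalIntegrable (by fun_prop) _ _)
  rw [intervalIntegral.integral_add (Continuous.intervalIntegrable (by fun_prop) _ _)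
    (Continuous.intervalIntegrable (by fun_prop) _ _)] at this
  simp only [hx, mul_zero, Real.sin_zero, zero_mul, sub_zero, mul_left_comm (x _),
    intervalIntegral.integral_const_mul] at this
  rw [inceCoefficient]
  linarith

lemma integral_mul_sin (h : IsInceSystem ε l x y) (hy : y 0 = 0) {n : ℝ}
    (hn : Real.cos (n * (Real.pi / 2)) = 0) :
    n * ∫ t in (0 : ℝ)..Real.pi / 2, y t * Real.sin (n * t) =
      -l * ∫ t in (0 : ℝ)..Real.pi / 2, x t * Real.cos (n * t) := by
  have hyc := h.continuous_right
  have hxc := h.continuous_left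
  have := intervalIntegral.integral_deriv_mul_eq_sub (a := 0) (b := Real.pi / 2)
    (fun t _ => h.right t) (fun t _ => hasDerivAt_cos_mul n t)
    (Continuous.intervalIntegrable (by fun_prop) _ _)
    (Continuous.intervalIntegrable (by fun_prop) _ _)
  rw [intervalIntegral.integral_add (Continuous.intervalIntegrable (by fun_prop) _ _)
    (Continuous.intervalIntegrable (by fun_prop) _ _)] at this
  simp only [hn, hy, mul_zero, zero_mul, sub_zero, mul_neg, mul_left_comm (y _), mul_assoc,
    intervalIntegral.integral_const_mul, intervalIntegral.integral_neg] at this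
  linarith

/-- The three-term recurrence for the Fourier coefficients of a solution which is even and
antisymmetric about `π / 2`. -/
lemma inceCoefficient_recurrence (h : IsInceSystem ε l x y) (hε : |ε| < 1)
    (hx : x (Real.pi / 2) = 0) (hy : y 0 = 0) {n : ℝ}
    (hn : Real.cos (n * (Real.pi / 2)) = 0) :
    l * inceCoefficient x n = n ^ 2 * (inceCoefficient x n +
      ε / 2 * (inceCoefficient x (n + 2) + inceCoefficient x (n - 2))) := by
  have hc := h.continuous_deriv hε
  -- Writing y = (1 + ε cos 2t) x' and expanding sin(nt) cos(2t) couples n to n ± 2.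
  have h1 : ∀ t, y t * Real.sin (n * t) = y t / inceCoeff ε t * Real.sin (n * t) +
      ε / 2 * (y t / inceCoeff ε t * Real.sin ((n + 2) * t) +
        y t / inceCoeff ε t * Real.sin ((n - 2) * t)) := fun t => by
    have hs : Real.sin ((n + 2) * t) + Real.sin ((n - 2) * t) =
        2 * Real.sin (n * t) * Real.cos (2 * t) := by
      rw [add_mul, sub_mul, Real.sin_add, Real.sin_sub]
      ring
    have hp := (inceCoeff_pos hε t).ne'
    rw [← mul_add, hs]
    nth_rewrite 1 [← div_mul_cancel₀ (y t) hp]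
    nth_rewrite 2 [inceCoeff]
    ring
  have h2 : ∫ t in (0 : ℝ)..Real.pi / 2, y t * Real.sin (n * t) = -(inceCoefficient x n +
      ε / 2 * (inceCoefficient x (n + 2) + inceCoefficient x (n - 2))) := by
    rw [intervalIntegral.integral_congr fun t _ => h1 t,
      intervalIntegral.integral_add (Continuous.intervalIntegrable (by fun_prop) _ _)
        (Continuous.intervalIntegrable (by fun_prop) _ _),
      intervalIntegral.integral_const_mul,
      intervalIntegral.integral_add (Continuous.intervalIntegrable (by fun_prop) _ _)
        (Continuous.intervalIntegrable (by fun_prop) _ _),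
      h.integral_deriv_mul_sin hε hx, h.integral_deriv_mul_sin hε hx,
      h.integral_deriv_mul_sin hε hx]
    ring
  have h3 := h.integral_mul_sin hy hn
  rw [h2] at h3
  have h4 : inceCoefficient x n = n * ∫ t in (0 : ℝ)..Real.pi / 2, x t * Real.cos (n * t) := rfl
  nth_rewrite 1 [h4]
  linear_combination n * h3

/-- As integrals of x' against sines, the coefficients are bounded uniformly in n, as
`IsLadder.tail_le` requires. -/
lemma exists_bound_inceCoefficient (h : IsInceSystem ε l x y) (hε : |ε| < 1)
    (hx : x (Real.pi / 2) = 0) : ∃ B, ∀ n, |inceCoefficient x n| ≤ B := by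
  obtain ⟨S, hS⟩ := isCompact_Icc.exists_bound_of_continuousOn (s := Set.Icc 0 (Real.pi / 2))
    (h.continuous_deriv hε).continuousOn
  refine ⟨S * |Real.pi / 2 - 0|, fun n => ?_⟩
  rw [← abs_neg, ← h.integral_deriv_mul_sin hε hx, ← Real.norm_eq_abs]
  refine intervalIntegral.norm_integral_le_of_norm_le_const fun t ht => ?_
  rw [Set.uIoc_of_le (by positivity)] at ht
  rw [norm_mul]
  exact (mul_le_of_le_one_right (norm_nonneg _) (Real.abs_sin_le_one _)).trans
    (hS t ⟨ht.1.le, ht.2⟩)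

lemma cos_odd_mul_pi_div_two (j : ℕ) : Real.cos ((2 * (j : ℝ) + 1) * (Real.pi / 2)) = 0 := by
  rw [Real.cos_eq_zero_iff]
  exact ⟨j, by push_cast; ring⟩

/-- Division by δ n² makes 1/δ the spectral parameter and γ/2 the coupling. The coefficient is odd
in n, so the neighbour n = -1 folds back onto n = 1 and gives the closing sign. -/
lemma isLadder {ω γ δ : ℝ} (hω : ω ≠ 0) (hδ : δ ≠ 0)
    (h : IsInceSystem (δ * γ) (4 * (δ / ω ^ 2)) x y) (hε : |δ * γ| < 1)
    (hx : x (Real.pi / 2) = 0) (hy : y 0 = 0) :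
    IsLadder (fun j => 1 / δ - 4 / (ω ^ 2 * (2 * (j : ℝ) + 1) ^ 2)) (γ / 2) (-(γ / 2))
      (fun j => inceCoefficient x (2 * j + 1)) := by
  have key := fun j : ℕ => h.inceCoefficient_recurrence hε hx hy (cos_odd_mul_pi_div_two j)
  have aux : ∀ n a b : ℝ, n ≠ 0 → 4 * (δ / ω ^ 2) * a = n ^ 2 * (a + δ * γ / 2 * b) →
      (1 / δ - 4 / (ω ^ 2 * n ^ 2)) * a + γ / 2 * b = 0 := fun n a b hn hab => by
    field_simp at hab ⊢
    linear_combination -hab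
  refine ⟨?_, fun j => ?_⟩
  · have h0 := aux _ _ _ (by positivity) (key 0)
    have e : inceCoefficient x (2 * ((0 : ℕ) : ℝ) + 1 - 2) = -inceCoefficient x 1 := by
      rw [← inceCoefficient_neg]
      norm_num
    rw [e] at h0
    norm_num at h0 ⊢
    linear_combination h0
  · have h1 := aux _ _ _ (by positivity) (key (j + 1))
    have e1 : 2 * ((j + 1 : ℕ) : ℝ) + 1 + 2 = 2 * ((j + 2 : ℕ) : ℝ) + 1 := by push_cast; ring
    have e2 : 2 * ((j + 1 : ℕ) : ℝ) + 1 - 2 = 2 * (j : ℝ) + 1 := by push_cast; ring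
    rwa [e1, e2] at h1

end IsInceSystem

/-- Changes the sign of the coupling but not of the closing term, so the ladder for -γ becomes one
for γ closed with the opposite sign. -/
lemma IsLadder.alternate {d : ℕ → ℝ} {g s : ℝ} {z : ℕ → ℝ} (h : IsLadder d g s z) :
    IsLadder d (-g) s (fun j => (-1) ^ j * z j) where
  zero := by linear_combination h.zero
  succ j := by
    simp only [pow_succ]
    linear_combination (-(-1) ^ j) * h.succ j

/-! ### Implicit curves and the frontier of the stable set. -/

/-- Analytic implicit function theorem for a simple zero in the second variable, with the sign of
the function on either side of the zero set. -/
theorem exists_analyticAt_implicit {f : ℝ × ℝ → ℝ} {y₀ m : ℝ} (hf : AnalyticAt ℝ f (0, y₀))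
    (h0 : f (0, y₀) = 0) (hm : fderiv ℝ f (0, y₀) (0, 1) = m) (hm0 : m ≠ 0) :
    ∃ a : ℝ → ℝ, AnalyticAt ℝ a 0 ∧ a 0 = y₀ ∧ (∀ᶠ x in 𝓝 0, f (x, a x) = 0) ∧
      ∀ᶠ p : ℝ × ℝ in 𝓝 (0, y₀), ∃ h, 0 < h ∧ f p = m * h * (p.2 - a p.1) := by
  have hcd : ContDiffAt ℝ ⊤ f (0, y₀) := hf.contDiffAt
  have hinv : (fderiv ℝ f (0, y₀) ∘L .inr ℝ ℝ ℝ).IsInvertible := by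
    refine ContinuousLinearMap.IsInvertible.of_inverse (g := m⁻¹ • ContinuousLinearMap.id ℝ ℝ) ?_ ?_
    · ext
      simp [hm, hm0]
    · ext
      simp [hm, hm0]
  have htop : (⊤ : WithTop ℕ∞) ≠ 0 := by simp
  set a := hcd.implicitFunction htop hinv with ha
  have haa : AnalyticAt ℝ a 0 := (hcd.contDiffAt_implicitFunction htop hinv).analyticAt
  have ha0 : a 0 = y₀ := hcd.implicitFunction_apply_self htop hinv
  have hz : ∀ᶠ x in 𝓝 0, f (x, a x) = 0 := by
    have := hcd.eventually_apply_implicitFunction htop hinv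
    rwa [h0] at this
  refine ⟨a, haa, ha0, hz, ?_⟩
  -- Strict differentiability compares f at p and at the point of the curve below or above it. The
  -- constant |m| / 2 keeps f p / (m d) within 1/2 of 1, hence positive.
  have hst := hf.hasStrictFDerivAt.isLittleO.def (c := |m| / 2) (by positivity)
  have hcurve : Filter.Tendsto (fun p : ℝ × ℝ => (p.1, a p.1)) (𝓝 (0, y₀)) (𝓝 (0, y₀)) := by
    have h1 : ContinuousAt (fun p : ℝ × ℝ => (p.1, a p.1)) (0, y₀) :=
      continuousAt_fst.prodMk
        (ContinuousAt.comp (f := fun p : ℝ × ℝ => p.1) (x := ((0 : ℝ), y₀)) haa.continuousAt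
          continuousAt_fst)
    simpa [ContinuousAt, ha0] using h1
  have hpair : Filter.Tendsto (fun p : ℝ × ℝ => (p, (p.1, a p.1))) (𝓝 (0, y₀))
      (𝓝 ((0, y₀), (0, y₀))) := Filter.tendsto_id.prodMk_nhds hcurve
  have hz' : ∀ᶠ p : ℝ × ℝ in 𝓝 (0, y₀), f (p.1, a p.1) = 0 :=
    (continuousAt_fst (p := ((0 : ℝ), y₀))).eventually hz
  filter_upwards [hpair.eventually hst, hz'] with p hp hp0
  set d := p.2 - a p.1 with hd
  have hsub : p - (p.1, a p.1) = d • ((0 : ℝ), (1 : ℝ)) := by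
    ext <;> simp [hd]
  simp only [hp0, hsub, map_smul, hm, sub_zero, smul_eq_mul, norm_smul, Real.norm_eq_abs] at hp
  have hone : ‖((0 : ℝ), (1 : ℝ))‖ = 1 := by simp
  rw [hone, mul_one] at hp
  by_cases hd0 : d = 0
  · refine ⟨1, one_pos, ?_⟩
    simpa [hd0] using hp
  · have hmd : 0 < |m * d| := abs_pos.2 (mul_ne_zero hm0 hd0)
    refine ⟨f p / (m * d), ?_, by field_simp⟩
    have h1 : |f p / (m * d) - 1| ≤ 1 / 2 := by
      rw [div_sub_one (mul_ne_zero hm0 hd0), abs_div, div_le_iff₀ hmd, abs_mul, mul_comm m d]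
      linarith
    linarith [(abs_le.1 h1).1]

/-- If the stable set near a point is the exterior of the wedge between two curves, together with
their intersection point, then its frontier is the union of the curves. -/
theorem eventually_mem_frontier_iff {S : Set (ℝ × ℝ)} {a b : ℝ → ℝ} {y₀ : ℝ}
    (ha0 : a 0 = y₀) (hb0 : b 0 = y₀) (ha : ∀ᶠ x in 𝓝 0, ContinuousAt a x)
    (hb : ∀ᶠ x in 𝓝 0, ContinuousAt b x) (hab : ∀ᶠ x in 𝓝 0, x ≠ 0 → a x ≠ b x)
    (hS : ∀ᶠ p : ℝ × ℝ in 𝓝 (0, y₀), p ∈ S ↔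
      0 < (p.2 - a p.1) * (p.2 - b p.1) ∨ p.2 = a p.1 ∧ p.2 = b p.1) :
    ∀ᶠ p : ℝ × ℝ in 𝓝 (0, y₀), p ∈ frontier S ↔ p.2 = a p.1 ∨ p.2 = b p.1 := by
  have key : ∀ (a b : ℝ → ℝ) (p : ℝ × ℝ), a 0 = y₀ → b 0 = y₀ → ContinuousAt a p.1 →
      (∀ᶠ x in 𝓝 p.1, x ≠ 0 → a x ≠ b x) → (∀ᶠ q : ℝ × ℝ in 𝓝 p, q ∈ S ↔
        0 < (q.2 - a q.1) * (q.2 - b q.1) ∨ q.2 = a q.1 ∧ q.2 = b q.1) →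
      p.2 = a p.1 → p ∈ frontier S := by
    rintro a b ⟨x, y⟩ ha0 hb0 ha hab hS hy
    obtain rfl : y = a x := hy
    rw [frontier_eq_closure_inter_closure]
    have hx := hS.self_of_nhds
    -- The crossing point lies in S but is a limit of curve points outside S. Any other curve point
    -- lies outside S, and moving vertically away from the other curve enters S.
    by_cases h : a x = b x
    · have hx0 : x = 0 := by
        by_contra hx0
        exact hab.self_of_nhds hx0 h
      subst hx0
      refine ⟨subset_closure (hx.2 (Or.inr ⟨rfl, h⟩)), ?_⟩
      have ht : Filter.Tendsto (fun x => (x, a x)) (𝓝[≠] 0) (𝓝 (0, a 0)) :=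
        (continuousAt_id.prodMk ha).tendsto.mono_left nhdsWithin_le_nhds
      refine mem_closure_of_tendsto ht ?_
      filter_upwards [ht.eventually hS, nhdsWithin_le_nhds hab, self_mem_nhdsWithin]
        with x h1 h2 h3
      change ¬ (x, a x) ∈ S
      rw [h1]
      simpa using h2 h3
    · refine ⟨?_, subset_closure ?_⟩
      · have ht : Filter.Tendsto (fun s : ℝ => (x, a x + s * (a x - b x))) (𝓝[>] 0)
            (𝓝 (x, a x)) := by
          have hc : Continuous fun s : ℝ => (x, a x + s * (a x - b x)) := by fun_prop
          have := (hc.tendsto 0).mono_left (nhdsWithin_le_nhds (s := Set.Ioi 0))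
          simpa using this
        refine mem_closure_of_tendsto ht ?_
        filter_upwards [ht.eventually hS, self_mem_nhdsWithin] with s h1 h2
        refine h1.2 (Or.inl ?_)
        have h3 : 0 < (a x - b x) ^ 2 := by
          have := sub_ne_zero.2 h
          positivity
        have h4 : 0 < s := h2
        have h5 : (a x + s * (a x - b x) - a x) * (a x + s * (a x - b x) - b x) =
            s * (1 + s) * (a x - b x) ^ 2 := by ring
        rw [h5]
        positivity
      · change ¬ (x, a x) ∈ S
        rw [hx]
        simpa using h
  have hfst : Filter.Tendsto (fun p : ℝ × ℝ => p.1) (𝓝 (0, y₀)) (𝓝 0) :=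
    continuousAt_fst (p := ((0 : ℝ), y₀))
  filter_upwards [hfst.eventually ha, hfst.eventually hb,
    hfst.eventually (eventually_eventually_nhds.2 hab), eventually_eventually_nhds.2 hS]
    with p h1 h2 h3 h4
  constructor
  · intro hp
    by_contra! hne
    have hprod : (p.2 - a p.1) * (p.2 - b p.1) ≠ 0 :=
      mul_ne_zero (sub_ne_zero.2 hne.1) (sub_ne_zero.2 hne.2)
    have hcont : ContinuousAt (fun q : ℝ × ℝ => (q.2 - a q.1) * (q.2 - b q.1)) p :=
      (continuousAt_snd.sub (ContinuousAt.comp (f := fun q : ℝ × ℝ => q.1) h1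
        continuousAt_fst)).mul
        (continuousAt_snd.sub (ContinuousAt.comp (f := fun q : ℝ × ℝ => q.1) h2
          continuousAt_fst))
    rw [frontier_eq_closure_inter_closure, Set.mem_inter_iff, mem_closure_iff_frequently,
      mem_closure_iff_frequently] at hp
    rcases hprod.lt_or_gt with hlt | hgt
    · refine hp.1 ?_
      filter_upwards [h4, hcont.eventually_lt_const hlt] with q hq1 hq2
      rw [hq1]
      rintro (h | ⟨h, -⟩)
      · exact hq2.not_gt h
      · simp [h] at hq2
    · refine hp.2 ?_
      filter_upwards [h4, hcont.eventually_const_lt hgt] with q hq1 hq2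
      exact not_not.2 (hq1.2 (Or.inl hq2))
  · rintro (h | h)
    · exact key a b p ha0 hb0 h1 h3 h4 h
    · refine key b a p hb0 ha0 h2 (h3.mono fun x hx h0 => (hx h0).symm) (h4.mono fun q hq => ?_) h
      rw [hq, mul_comm, and_comm]

/-! ### Orders of vanishing and Taylor coefficients. -/

lemma isTheta_one_of_tendsto {α : Type*} {l : Filter α} {g : α → ℝ} {c : ℝ}
    (h : Filter.Tendsto g l (𝓝 c)) (hc : c ≠ 0) : g =Θ[l] fun _ => (1 : ℝ) :=
  ((Asymptotics.isEquivalent_const_iff_tendsto hc).2 h).isTheta.trans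
    (Asymptotics.isTheta_const_const hc one_ne_zero)

/-- An analytic function of order N is Θ(x^N), and distinct powers are not Θ of each other. -/
lemma analyticOrderAt_eq_of_isTheta {f : ℝ → ℝ} {n : ℕ} (hf : AnalyticAt ℝ f 0)
    (h : f =Θ[𝓝 0] fun x => x ^ n) : analyticOrderAt f 0 = n := by
  have hne : ∀ k : ℕ, ∃ᶠ x : ℝ in 𝓝 0, x ^ k ≠ 0 := fun k => by
    have : ∀ᶠ x : ℝ in 𝓝[≠] 0, x ^ k ≠ 0 := by
      filter_upwards [self_mem_nhdsWithin] with x hx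
      exact pow_ne_zero k hx
    exact this.frequently.filter_mono nhdsWithin_le_nhds
  have htop : analyticOrderAt f 0 ≠ ⊤ := by
    rw [Ne, analyticOrderAt_eq_top]
    intro h0
    have h1 : (fun x : ℝ => x ^ n) =O[𝓝 0] fun _ => (0 : ℝ) := h.2.trans_eventuallyEq h0
    exact hne n ((Asymptotics.isBigO_zero_right_iff.1 h1).mono fun x hx => not_not.2 hx)
  obtain ⟨N, hN⟩ := ENat.ne_top_iff_exists.1 htop
  obtain ⟨g, hg, hg0, hfg⟩ := hf.analyticOrderAt_eq_natCast.1 hN.symm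
  have hgt : g =Θ[𝓝 0] fun _ => (1 : ℝ) :=
    isTheta_one_of_tendsto hg.continuousAt hg0
  have hfN : f =Θ[𝓝 0] fun x => x ^ N := by
    have h1 : (fun x : ℝ => x ^ N * g x) =Θ[𝓝 0] fun x => x ^ N * 1 :=
      (Asymptotics.isTheta_refl _ _).mul hgt
    simp only [mul_one] at h1
    refine Asymptotics.IsTheta.trans ?_ h1
    exact Filter.EventuallyEq.isTheta (hfg.mono fun x hx => by simpa using hx)
  have hNn : (fun x : ℝ => x ^ N) =Θ[𝓝 0] fun x => x ^ n := hfN.symm.trans h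
  rw [← hN]
  rcases lt_trichotomy N n with hlt | heq | hlt
  · exact absurd (Asymptotics.isLittleO_pow_pow hlt) (hNn.1.not_isLittleO (hne N))
  · rw [heq]
  · exact absurd (Asymptotics.isLittleO_pow_pow hlt) (hNn.2.not_isLittleO (hne n))

lemma iteratedDeriv_eq_and_ne_of_isTheta {a b : ℝ → ℝ} {n : ℕ} (ha : AnalyticAt ℝ a 0)
    (hb : AnalyticAt ℝ b 0) (h : (fun x => a x - b x) =Θ[𝓝 0] fun x => x ^ n) :
    (∀ j < n, iteratedDeriv j a 0 = iteratedDeriv j b 0) ∧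
      iteratedDeriv n a 0 ≠ iteratedDeriv n b 0 := by
  have h1 := (analyticOrderAt_eq_nat_iff_iteratedDeriv_eq_zero (ha.sub hb)).1
    (analyticOrderAt_eq_of_isTheta (ha.sub hb) h)
  have h2 : ∀ j, iteratedDeriv j (a - b) 0 = iteratedDeriv j a 0 - iteratedDeriv j b 0 :=
    fun j => iteratedDeriv_sub ha.contDiffAt hb.contDiffAt
  simp only [h2, sub_eq_zero] at h1
  exact ⟨h1.1, sub_ne_zero.1 h1.2⟩

/-! ### Unperturbed levels and the gap between reciprocals. -/

lemma StrictAnti.exists_gap {κ : ℕ → ℝ} (h : StrictAnti κ) (K : ℕ) :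
    ∃ c, 0 < c ∧ ∀ j, j ≠ K → c ≤ |κ j - κ K| := by
  have hup : 0 < κ K - κ (K + 1) := sub_pos.2 (h (Nat.lt_succ_self K))
  have hj : ∀ j, K < j → κ K - κ (K + 1) ≤ |κ j - κ K| := fun j hj => by
    rw [abs_sub_comm]
    exact (sub_le_sub_left (h.antitone hj) _).trans (le_abs_self _)
  rcases K with _ | K
  · exact ⟨_, hup, fun j hj0 => hj j (Nat.pos_of_ne_zero hj0)⟩
  · have hlow : 0 < κ K - κ (K + 1) := sub_pos.2 (h (Nat.lt_succ_self K))
    refine ⟨min (κ (K + 1) - κ (K + 1 + 1)) (κ K - κ (K + 1)), lt_min hup hlow, fun j hjK => ?_⟩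
    rcases hjK.lt_or_gt with hlt | hgt
    · exact (min_le_right _ _).trans ((sub_le_sub_right (h.antitone (Nat.le_of_lt_succ hlt)) _).trans
        (le_abs_self _))
    · exact (min_le_left _ _).trans (hj j hgt)

/-- The eigenvalues `1 / δ` of the Ince problem at `γ = 0`. -/
noncomputable def inceLevel (ω : ℝ) (j : ℕ) : ℝ := 4 / (ω ^ 2 * (2 * (j : ℝ) + 1) ^ 2)

lemma inceLevel_pos {ω : ℝ} (hω : 0 < ω) (j : ℕ) : 0 < inceLevel ω j := by
  unfold inceLevel
  positivity

lemma strictAnti_inceLevel {ω : ℝ} (hω : 0 < ω) : StrictAnti (inceLevel ω) := by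
  intro i j hij
  have : (i : ℝ) < j := by exact_mod_cast hij
  unfold inceLevel
  gcongr

/-- Parameters at which the quarter-period boundary value problem is solvable, for `γ` and for
`-γ`, have reciprocals separated by an exact power of `γ`. -/
theorem inverse_gap {ω : ℝ} (hω : 0 < ω) (K : ℕ) :
    ∃ e, 0 < e ∧ ∃ A B : ℝ, ∀ γ δ δ' : ℝ, ∀ x y x' y' : ℝ → ℝ,
      |γ| ≤ e → 0 < δ → 0 < δ' → |1 / δ - inceLevel ω K| ≤ e → |1 / δ' - inceLevel ω K| ≤ e →
      |δ * γ| < 1 → |δ' * -γ| < 1 →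
      IsInceSystem (δ * γ) (4 * (δ / ω ^ 2)) x y →
      IsInceSystem (δ' * -γ) (4 * (δ' / ω ^ 2)) x' y' →
      x (Real.pi / 2) = 0 → y 0 = 0 → x' (Real.pi / 2) = 0 → y' 0 = 0 →
      inceCoefficient x (2 * K + 1) ≠ 0 → inceCoefficient x' (2 * K + 1) ≠ 0 →
      |1 / δ - 1 / δ'| ≤ A * |γ ^ (2 * K + 1)| ∧ |γ ^ (2 * K + 1)| ≤ B * |1 / δ - 1 / δ'| := by
  obtain ⟨c, hc, hgap⟩ := (strictAnti_inceLevel hω).exists_gap K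
  set C := c / 4 + inceLevel ω 0 with hCdef
  have hC : 0 ≤ C := by
    have := inceLevel_pos hω 0
    positivity
  -- The radius c / 8 keeps 1/δ at distance at least c / 2 from every other level and ensures |γ /
  -- 2| ≤ (c / 2) / 8, as `IsLadder.gap` demands.
  refine ⟨c / 8, by positivity, 4 / 2 ^ (2 * K + 1) / (c / 4) ^ (2 * K),
    2 ^ (2 * K + 1) * (2 * C) ^ (2 * K), ?_⟩
  intro γ δ δ' x y x' y' hγ hδ hδ' hθ hθ' hε hε' hs hs' hx hy hx' hy' hK hK'
  have hlad := hs.isLadder hω.ne' hδ.ne' hε hx hy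
  have hlad' := (hs'.isLadder hω.ne' hδ'.ne' hε' hx' hy').alternate
  have hg1 : -(-γ / 2) = γ / 2 := by ring
  rw [hg1] at hlad'
  obtain ⟨B, hB⟩ := hs.exists_bound_inceCoefficient hε hx
  obtain ⟨B', hB'⟩ := hs'.exists_bound_inceCoefficient hε' hx'
  have hbounds : ∀ θ, |θ - inceLevel ω K| ≤ c / 8 → ∀ j, j ≠ K →
      c / 2 ≤ |θ - inceLevel ω j| ∧ |θ - inceLevel ω j| ≤ C := fun θ hθ j hj => by
    have h1 := hgap j hj
    have h2 := abs_sub_le (inceLevel ω j) θ (inceLevel ω K)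
    rw [abs_sub_comm (inceLevel ω j) θ] at h2
    refine ⟨by linarith, ?_⟩
    have h3 := abs_sub_le θ (inceLevel ω K) (inceLevel ω j)
    have h4 : |inceLevel ω K - inceLevel ω j| ≤ inceLevel ω 0 := by
      rw [abs_le]
      have a1 := (strictAnti_inceLevel hω).antitone (Nat.zero_le K)
      have a2 := (strictAnti_inceLevel hω).antitone (Nat.zero_le j)
      have a3 := inceLevel_pos hω K
      have a4 := inceLevel_pos hω j
      constructor <;> linarith
    rw [hCdef]
    linarith
  have hg : |γ / 2| ≤ c / 2 / 8 := by
    rw [abs_div, abs_two]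
    linarith
  obtain ⟨r1, r2⟩ := IsLadder.gap (K := K) (c := c / 2) (C := C) (κ := inceLevel ω) hlad hlad'
    ⟨B, fun j => hB _⟩
    ⟨B', fun j => by rw [abs_mul, abs_pow, abs_neg, abs_one, one_pow, one_mul]; exact hB' _⟩
    hK (mul_ne_zero (pow_ne_zero _ (by norm_num)) hK') (by positivity) hC hg
    (hbounds _ hθ) (hbounds _ hθ')
  have e1 : c / 2 / 2 = c / 4 := by ring
  rw [abs_div, abs_two, e1, div_pow |γ|] at r1
  rw [abs_div, abs_two, div_pow] at r2
  rw [abs_pow]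
  constructor
  · have h4 : 0 < (c / 4) ^ (2 * K) := by positivity
    rw [div_mul_eq_mul_div, le_div_iff₀ h4]
    calc _ ≤ _ := r1
      _ = _ := by ring
  · rw [div_le_iff₀ (by positivity)] at r2
    calc _ ≤ _ := r2
      _ = _ := by ring

/-! ### The half-period function near a resonance. -/

lemma IsInceFundamental.eq_cos {κ : ℝ} {x₁ y₁ x₂ y₂ : ℝ → ℝ}
    (h : IsInceFundamental 0 (κ ^ 2) x₁ y₁ x₂ y₂) (t : ℝ) : x₁ t = Real.cos (κ * t) := by
  have hs : IsInceSystem 0 (κ ^ 2) (fun t => Real.cos (κ * t))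
      (fun t => -(κ * Real.sin (κ * t))) := by
    refine ⟨fun t => ?_, fun t => ?_⟩
    · simpa [inceCoeff] using hasDerivAt_cos_mul κ t
    · exact ((hasDerivAt_sin_mul κ t).const_mul κ).neg.congr_deriv (by ring)
  have := h.left_eq hs t
  simp only [mul_zero, Real.cos_zero, Real.sin_zero, neg_zero, zero_mul, add_zero, one_mul] at this
  exact this.symm

/-- Shows that the resonant coefficient z K is nonzero at γ = 0, hence nearby by continuity. -/
lemma integral_cos_sq_odd (K : ℕ) :
    ∫ t in (0 : ℝ)..Real.pi / 2, Real.cos ((2 * (K : ℝ) + 1) * t) * Real.cos ((2 * K + 1) * t) =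
      Real.pi / 4 := by
  set n : ℝ := 2 * K + 1 with hn
  have hn0 : n ≠ 0 := by positivity
  have hd : ∀ t, HasDerivAt (fun t => t / 2 + (2 * n)⁻¹ * (Real.sin (n * t) * Real.cos (n * t)))
      (Real.cos (n * t) * Real.cos (n * t)) t := fun t => by
    refine (((hasDerivAt_id t).div_const 2).add
      (((hasDerivAt_sin_mul n t).mul (hasDerivAt_cos_mul n t)).const_mul (2 * n)⁻¹)).congr_deriv ?_
    field_simp
    linear_combination (-1 : ℝ) * Real.sin_sq_add_cos_sq (n * t)
  rw [intervalIntegral.integral_eq_sub_of_hasDerivAt (fun t _ => hd t)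
    (Continuous.intervalIntegrable (by fun_prop) _ _)]
  have hc := IsInceSystem.cos_odd_mul_pi_div_two K
  rw [← hn] at hc
  simp [hc]
  ring

/-- Near a resonance `δ = ((2 K + 1) ω / 2) ^ 2`, the stability properties of the Ince equation
are governed by an analytic function `f`, the half-period value of the even solution. -/
theorem exists_halfPeriod_function {ω : ℝ} (hω : 0 < ω) (K : ℕ) :
    ∃ (f : ℝ × ℝ → ℝ) (m : ℝ) (x y : ℝ × ℝ → ℝ → ℝ),
      AnalyticAt ℝ f (0, ((2 * (K : ℝ) + 1) * ω / 2) ^ 2) ∧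
      f (0, ((2 * (K : ℝ) + 1) * ω / 2) ^ 2) = 0 ∧ m ≠ 0 ∧
      fderiv ℝ f (0, ((2 * (K : ℝ) + 1) * ω / 2) ^ 2) (0, 1) = m ∧
      ∀ᶠ p : ℝ × ℝ in 𝓝 (0, ((2 * (K : ℝ) + 1) * ω / 2) ^ 2),
        (|p.2 * p.1| < 1 ∧ IsInceSystem (p.2 * p.1) (4 * (p.2 / ω ^ 2)) (x p) (y p) ∧
          x p (Real.pi / 2) = f p ∧ y p 0 = 0 ∧ inceCoefficient (x p) (2 * K + 1) ≠ 0) ∧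
        (HasEvenPeriodicSolution ω p.1 p.2 ↔ f p = 0) ∧
        (HasOddPeriodicSolution ω p.1 p.2 ↔ f (-p.1, p.2) = 0) ∧
        (OriginStable ω p.1 p.2 ↔ 0 < f p * f (-p.1, p.2) ∨ f p = 0 ∧ f (-p.1, p.2) = 0) := by
  set n : ℝ := 2 * K + 1 with hn
  have hn0 : 0 < n := by positivity
  set δ₀ := (n * ω / 2) ^ 2 with hδ₀
  obtain ⟨x₁, y₁, x₂, y₂, hfund, han, hcoef⟩ := exists_isInceFundamental (n ^ 2)
  set φ : ℝ × ℝ → ℝ × ℝ := fun p => (p.2 * p.1, 4 * (p.2 / ω ^ 2)) with hφ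
  have hφ0 : φ (0, δ₀) = (0, n ^ 2) := by
    simp only [hφ, hδ₀, mul_zero, Prod.mk.injEq, true_and]
    field_simp
    ring
  have hφa : AnalyticAt ℝ φ (0, δ₀) := by
    refine (analyticAt_snd.mul analyticAt_fst).prod (analyticAt_const.mul ?_)
    exact analyticAt_snd.div analyticAt_const (by positivity)
  have hφt : Filter.Tendsto φ (𝓝 (0, δ₀)) (𝓝 (0, n ^ 2)) := by
    have := hφa.continuousAt.tendsto
    rwa [hφ0] at this
  have hflip : Filter.Tendsto (fun p : ℝ × ℝ => (-p.1, p.2)) (𝓝 (0, δ₀)) (𝓝 (0, δ₀)) := by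
    have : ContinuousAt (fun p : ℝ × ℝ => (-p.1, p.2)) (0, δ₀) := by fun_prop
    simpa [ContinuousAt] using this
  set f : ℝ × ℝ → ℝ := fun p => x₁ (φ p) (Real.pi / 2) with hf
  have hfa : AnalyticAt ℝ f (0, δ₀) :=
    AnalyticAt.comp (g := fun p => x₁ p (Real.pi / 2)) (by rwa [hφ0]) hφa
  have hcos : ∀ᶠ δ in 𝓝 δ₀, f (0, δ) = Real.cos (2 * √δ / ω * (Real.pi / 2)) := by
    have ht : Filter.Tendsto (fun δ : ℝ => ((0 : ℝ), δ)) (𝓝 δ₀) (𝓝 (0, δ₀)) := by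
      have : ContinuousAt (fun δ : ℝ => ((0 : ℝ), δ)) δ₀ := by fun_prop
      exact this
    filter_upwards [(hφt.comp ht).eventually hfund,
      eventually_gt_nhds (show 0 < δ₀ by positivity)] with δ hδ hpos
    have h1 := hδ.2
    simp only [Function.comp, hφ, mul_zero] at h1
    have h2 : 4 * (δ / ω ^ 2) = (2 * √δ / ω) ^ 2 := by
      rw [div_pow, mul_pow, Real.sq_sqrt hpos.le]
      ring
    have h3 : f (0, δ) = x₁ (0, 4 * (δ / ω ^ 2)) (Real.pi / 2) := by simp [hf, hφ]
    rw [h3]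
    generalize x₁ (0, 4 * (δ / ω ^ 2)) = X at h1 ⊢
    rw [h2] at h1
    exact h1.eq_cos _
  have hsqrt : √δ₀ = n * ω / 2 := Real.sqrt_sq (by positivity)
  have hcosn := IsInceSystem.cos_odd_mul_pi_div_two K
  rw [← hn] at hcosn
  have harg : 2 * √δ₀ / ω * (Real.pi / 2) = n * (Real.pi / 2) := by
    rw [hsqrt]
    field_simp
  have hf0 : f (0, δ₀) = 0 := by rw [hcos.self_of_nhds, harg, hcosn]
  have hder : fderiv ℝ f (0, δ₀) (0, 1) =
      -Real.sin (n * (Real.pi / 2)) * (2 * (1 / (2 * √δ₀)) / ω * (Real.pi / 2)) := by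
    have h1 : HasDerivAt (fun δ : ℝ => f (0, δ)) (fderiv ℝ f (0, δ₀) (0, 1)) δ₀ :=
      hfa.differentiableAt.hasFDerivAt.comp_hasDerivAt δ₀
        ((hasDerivAt_const δ₀ (0 : ℝ)).prodMk (hasDerivAt_id δ₀))
    have h2 : HasDerivAt (fun δ : ℝ => Real.cos (2 * √δ / ω * (Real.pi / 2)))
        (-Real.sin (2 * √δ₀ / ω * (Real.pi / 2)) * (2 * (1 / (2 * √δ₀)) / ω * (Real.pi / 2))) δ₀ :=
      ((((Real.hasDerivAt_sqrt (by positivity)).const_mul 2).div_const ω).mul_const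
        (Real.pi / 2)).cos
    rw [harg] at h2
    exact (h1.congr_of_eventuallyEq (hcos.mono fun δ hδ => hδ.symm)).unique h2
  -- The zero is simple: sine cannot vanish where cosine does.
  have hm : fderiv ℝ f (0, δ₀) (0, 1) ≠ 0 := by
    rw [hder]
    refine mul_ne_zero (neg_ne_zero.2 fun hs => ?_) ?_
    · have := Real.sin_sq_add_cos_sq (n * (Real.pi / 2))
      rw [hs, hcosn] at this
      norm_num at this
    · rw [hsqrt]
      positivity
  have hcoef0 : ∀ᶠ p in 𝓝 (0, δ₀), inceCoefficient (x₁ (φ p)) n ≠ 0 := by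
    have hbase : ∫ t in (0 : ℝ)..Real.pi / 2, x₁ (0, n ^ 2) t * Real.cos (n * t) = Real.pi / 4 := by
      rw [hn, ← integral_cos_sq_odd K, ← hn]
      refine intervalIntegral.integral_congr fun t _ => ?_
      simp only [hfund.self_of_nhds.2.eq_cos t]
    have hev : ∀ᶠ q in 𝓝 (0, n ^ 2),
        ∫ t in (0 : ℝ)..Real.pi / 2, x₁ q t * Real.cos (n * t) ≠ 0 :=
      (hcoef n).eventually_ne (by rw [hbase]; positivity)
    filter_upwards [hφt.eventually hev] with p hp
    exact mul_ne_zero hn0.ne' hp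
  have hlt : ∀ᶠ p : ℝ × ℝ in 𝓝 (0, δ₀), f p * f (-p.1, p.2) < 1 := by
    have h1 : Filter.Tendsto f (𝓝 (0, δ₀)) (𝓝 0) := by
      have := hfa.continuousAt.tendsto
      rwa [hf0] at this
    have h2 := h1.mul (h1.comp hflip)
    rw [mul_zero] at h2
    exact h2.eventually_lt_const one_pos
  refine ⟨f, _, fun p => x₁ (φ p), fun p => y₁ (φ p), hfa, hf0, hm, rfl, ?_⟩
  filter_upwards [hφt.eventually hfund, (hφt.comp hflip).eventually hfund, hcoef0, hlt]
    with p h1 h2 h3 h4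
  obtain ⟨hε, h1⟩ := h1
  have h2 := h2.2
  have hG : y₂ (φ p) (Real.pi / 2) = f (-p.1, p.2) := by
    refine h1.y₂_pi_div_two (v := y₁ (φ (-p.1, p.2))) ?_ h2.x₁_zero h2.y₁_zero
    have := h2.fst
    simpa [hφ] using this
  have hlt' : x₁ (φ p) (Real.pi / 2) * y₂ (φ p) (Real.pi / 2) < 1 := by rwa [hG]
  refine ⟨⟨hε, h1.fst, rfl, h1.y₁_zero, h3⟩, hasEvenPeriodicSolution_iff hε h1 hlt', ?_, ?_⟩
  · rw [hasOddPeriodicSolution_iff hε h1 hlt', hG]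
  · rw [← hG]
    refine ⟨fun hst => ?_, originStable_of_pos hε h1 hlt'⟩
    by_contra! hne
    exact not_originStable_of_nonpos hε h1 hne.1 (fun h => hne.2 h.1 h.2) hst

/-! ### Assembling the transition curves. -/

theorem proposition1 (ω : ℝ) (hω : 0 < ω) (k : ℕ) (hk : 1 ≤ k) :
    ∃ a b : ℝ → ℝ,
      -- two analytic curves `δ = a γ`, `δ = b γ` emanating from `((2k-1)ω/2)²`
      AnalyticAt ℝ a 0 ∧ AnalyticAt ℝ b 0 ∧
      a 0 = ((2 * (k : ℝ) - 1) * ω / 2) ^ 2 ∧ b 0 = ((2 * (k : ℝ) - 1) * ω / 2) ^ 2 ∧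
      (∀ᶠ p : ℝ × ℝ in 𝓝 ((0 : ℝ), ((2 * (k : ℝ) - 1) * ω / 2) ^ 2),
        -- they are the transition curves near that point: the periodic-solution loci ...
        (HasEvenPeriodicSolution ω p.1 p.2 ↔ p.2 = a p.1) ∧
        (HasOddPeriodicSolution ω p.1 p.2 ↔ p.2 = b p.1) ∧
        -- ... and the boundary of the stability region
        (p ∈ stabilityBoundary ω ↔ p.2 = a p.1 ∨ p.2 = b p.1) ∧
        -- the instability tongue is what lies between them
        (¬ OriginStable ω p.1 p.2 ↔ p.1 ≠ 0 ∧ p.2 ∈ Set.uIcc (a p.1) (b p.1))) ∧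
      -- the expansions agree up to order `2k-2` and differ at order `2k-1`
      (∀ j ≤ 2 * k - 2, iteratedDeriv j a 0 = iteratedDeriv j b 0) ∧
      iteratedDeriv (2 * k - 1) a 0 ≠ iteratedDeriv (2 * k - 1) b 0 ∧
      -- the width of the tongue is of order exactly `γ^(2k-1)`
      (fun γ : ℝ => |a γ - b γ|) =Θ[𝓝 0] (fun γ : ℝ => γ ^ (2 * k - 1)) := by
  obtain ⟨K, rfl⟩ : ∃ K, k = K + 1 := ⟨k - 1, by omega⟩
  have hcast : 2 * ((K + 1 : ℕ) : ℝ) - 1 = 2 * K + 1 := by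
    push_cast
    ring
  rw [hcast, show 2 * (K + 1) - 2 = 2 * K by omega, show 2 * (K + 1) - 1 = 2 * K + 1 by omega]
  obtain ⟨f, m, x, y, hfa, hf0, hm0, hm, hev⟩ := exists_halfPeriod_function hω K
  set δ₀ := ((2 * (K : ℝ) + 1) * ω / 2) ^ 2 with hδ₀
  have hδ₀pos : 0 < δ₀ := by positivity
  obtain ⟨a, haa, ha0, haz, hsign⟩ := exists_analyticAt_implicit hfa hf0 hm hm0
  have hneg : Filter.Tendsto (fun γ : ℝ => -γ) (𝓝 0) (𝓝 0) := by
    simpa using (continuous_neg (G := ℝ)).tendsto 0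
  have hflip : Filter.Tendsto (fun p : ℝ × ℝ => (-p.1, p.2)) (𝓝 (0, δ₀)) (𝓝 (0, δ₀)) := by
    have : ContinuousAt (fun p : ℝ × ℝ => (-p.1, p.2)) (0, δ₀) := by fun_prop
    simpa [ContinuousAt] using this
  set b : ℝ → ℝ := fun γ => a (-γ) with hb
  have hba : AnalyticAt ℝ b 0 :=
    AnalyticAt.comp (g := a) (f := fun γ : ℝ => -γ) (by simpa using haa) analyticAt_id.neg
  have hb0 : b 0 = δ₀ := by simp [hb, ha0]
  have hat : Filter.Tendsto a (𝓝 0) (𝓝 δ₀) := ha0 ▸ haa.continuousAt.tendsto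
  have hbt : Filter.Tendsto b (𝓝 0) (𝓝 δ₀) := hb0 ▸ hba.continuousAt.tendsto
  have hca : Filter.Tendsto (fun γ => (γ, a γ)) (𝓝 0) (𝓝 (0, δ₀)) :=
    Filter.tendsto_id.prodMk_nhds hat
  have hcb : Filter.Tendsto (fun γ => (-γ, b γ)) (𝓝 0) (𝓝 (0, δ₀)) := hneg.prodMk_nhds hbt
  have hgap : (fun γ => 1 / a γ - 1 / b γ) =Θ[𝓝 0] fun γ => γ ^ (2 * K + 1) := by
    obtain ⟨e, he, A, B, hAB⟩ := inverse_gap hω K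
    have hlevel : ∀ c : ℝ → ℝ, Filter.Tendsto c (𝓝 0) (𝓝 δ₀) →
        ∀ᶠ γ in 𝓝 0, |1 / c γ - inceLevel ω K| ≤ e := fun c hc => by
      have h1 := ((hc.inv₀ hδ₀pos.ne').sub_const (inceLevel ω K)).abs
      have h2 : |δ₀⁻¹ - inceLevel ω K| = 0 := by
        rw [abs_eq_zero, sub_eq_zero, inceLevel, hδ₀]
        field_simp
        norm_num
      rw [h2] at h1
      filter_upwards [h1.eventually_le_const he] with γ hγ
      rwa [one_div]
    have hsmall : ∀ᶠ γ : ℝ in 𝓝 0, |γ| ≤ e := by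
      have := (continuous_abs (G := ℝ)).tendsto 0
      rw [abs_zero] at this
      exact this.eventually_le_const he
    have hall : ∀ᶠ γ in 𝓝 0, |1 / a γ - 1 / b γ| ≤ A * |γ ^ (2 * K + 1)| ∧
        |γ ^ (2 * K + 1)| ≤ B * |1 / a γ - 1 / b γ| := by
      filter_upwards [hsmall, hat.eventually_const_lt hδ₀pos, hbt.eventually_const_lt hδ₀pos,
        hlevel a hat, hlevel b hbt, hca.eventually hev, hcb.eventually hev, haz,
        hneg.eventually haz] with γ h1 h2 h3 h4 h5 h6 h7 h8 h9
      obtain ⟨⟨p1, p2, p3, p4, p5⟩, -⟩ := h6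
      obtain ⟨⟨q1, q2, q3, q4, q5⟩, -⟩ := h7
      exact hAB γ (a γ) (b γ) _ _ _ _ h1 h2 h3 h4 h5 p1 q1 p2 q2 (p3.trans h8) p4 (q3.trans h9) q4
        p5 q5
    exact ⟨.of_bound A (hall.mono fun γ h => h.1), .of_bound B (hall.mono fun γ h => h.2)⟩
  -- Here a - b = -(a b)(1/a - 1/b), and a b tends to δ₀² ≠ 0.
  have htheta : (fun γ => a γ - b γ) =Θ[𝓝 0] fun γ => γ ^ (2 * K + 1) := by
    have hprod : (fun γ => -(a γ * b γ)) =Θ[𝓝 0] fun _ => (1 : ℝ) :=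
      isTheta_one_of_tendsto (hat.mul hbt).neg (by simp [hδ₀pos.ne'])
    have h1 := hprod.mul hgap
    simp only [one_mul] at h1
    refine Asymptotics.IsTheta.trans (Filter.EventuallyEq.isTheta ?_) h1
    filter_upwards [hat.eventually_const_lt hδ₀pos, hbt.eventually_const_lt hδ₀pos] with γ h2 h3
    field_simp
    ring
  have hne : ∀ᶠ γ in 𝓝 0, γ ≠ 0 → a γ ≠ b γ := by
    obtain ⟨B, hB⟩ := htheta.2.bound
    filter_upwards [hB] with γ hγ hγ0 hab
    rw [hab, sub_self, norm_zero, mul_zero] at hγ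
    exact pow_ne_zero _ hγ0 (norm_le_zero_iff.1 hγ)
  obtain ⟨hcoef, hcoef_ne⟩ := iteratedDeriv_eq_and_ne_of_isTheta haa hba htheta
  have hlocal : ∀ᶠ p : ℝ × ℝ in 𝓝 (0, δ₀),
      (HasEvenPeriodicSolution ω p.1 p.2 ↔ p.2 = a p.1) ∧
      (HasOddPeriodicSolution ω p.1 p.2 ↔ p.2 = b p.1) ∧
      (OriginStable ω p.1 p.2 ↔
        0 < (p.2 - a p.1) * (p.2 - b p.1) ∨ p.2 = a p.1 ∧ p.2 = b p.1) := by
    filter_upwards [hev, hsign, hflip.eventually hsign] with p ⟨_, h1, h2, h3⟩ ⟨r, hr, hfr⟩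
      ⟨s, hs, hfs⟩
    change f (-p.1, p.2) = m * s * (p.2 - b p.1) at hfs
    have z1 : f p = 0 ↔ p.2 = a p.1 := by
      rw [hfr, mul_eq_zero_iff_left (mul_ne_zero hm0 hr.ne'), sub_eq_zero]
    have z2 : f (-p.1, p.2) = 0 ↔ p.2 = b p.1 := by
      rw [hfs, mul_eq_zero_iff_left (mul_ne_zero hm0 hs.ne'), sub_eq_zero]
    have z3 : 0 < f p * f (-p.1, p.2) ↔ 0 < (p.2 - a p.1) * (p.2 - b p.1) := by
      have : f p * f (-p.1, p.2) = m ^ 2 * r * s * ((p.2 - a p.1) * (p.2 - b p.1)) := by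
        rw [hfr, hfs]
        ring
      rw [this]
      exact mul_pos_iff_of_pos_left (by positivity)
    exact ⟨h1.trans z1, h2.trans z2, by rw [h3, z1, z2, z3]⟩
  have hfrontier := eventually_mem_frontier_iff (S := {p : ℝ × ℝ | OriginStable ω p.1 p.2}) ha0 hb0
    (haa.eventually_analyticAt.mono fun _ h => h.continuousAt)
    (hba.eventually_analyticAt.mono fun _ h => h.continuousAt) hne
    (hlocal.mono fun p h => h.2.2)
  have hfst : Filter.Tendsto (fun p : ℝ × ℝ => p.1) (𝓝 (0, δ₀)) (𝓝 0) :=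
    continuousAt_fst (p := ((0 : ℝ), δ₀))
  refine ⟨a, b, haa, hba, ha0, hb0, ?_, fun j hj => hcoef j (by omega), hcoef_ne,
    htheta.norm_left⟩
  filter_upwards [hlocal, hfrontier, hfst.eventually hne] with p ⟨h1, h2, h3⟩ h4 h5
  refine ⟨h1, h2, h4, ?_⟩
  have huIcc : p.2 ∈ Set.uIcc (a p.1) (b p.1) ↔ (p.2 - a p.1) * (p.2 - b p.1) ≤ 0 := by
    rw [Set.mem_uIcc, mul_nonpos_iff, sub_nonneg, sub_nonneg, sub_nonpos, sub_nonpos, and_comm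
      (a := b p.1 ≤ p.2), and_comm (a := p.2 ≤ a p.1)]
  rw [h3, huIcc, not_or, not_lt, and_comm]
  -- At γ = 0 the curves meet, so a nonpositive product is a vanishing square and the point is the
  -- stable crossing; for γ ≠ 0 the curves are distinct and the exceptional case cannot occur.
  refine and_congr_left fun hle => ⟨?_, fun hγ h => h5 hγ (h.1.symm.trans h.2)⟩
  intro hnot hγ
  have hab : a p.1 = b p.1 := by simp [hγ, ha0, hb0]
  rw [← hab] at hle hnot
  have : p.2 - a p.1 = 0 := by nlinarith
  exact hnot ⟨sub_eq_zero.1 this, sub_eq_zero.1 this⟩
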